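/- Let $n \ge 0$ be an integer and $1 \le q < n+1$ (so in fact $n\ge 1$). Write points of $\mathbb{R}^{n+1}=\mathbb{R}^n\times\mathbb{R}$ as $\hat x=(x,z)$, $\hat y=(y,w)$. For compact $K\subset\mathbb{R}^{n+1}$ the Riesz $q$-energy is $$V_q(K)=\min_\mu\int_K\!\int_K |\hat x-\hat y|^{-q}\,d\mu(\hat x)\,d\mu(\hat y),$$ the minimum being over Borel probability measures on $K$ (and $V_q(\emptyset)=+\infty$). For $t>0$ and $j\in\mathbb{Z}$ let $\rho_j(y,w)=(y,\,2tj+(-1)^jw)$, and on the strip $S(t)=\mathbb{R}^n\times(-t,t)$ let $$G_t(\hat x,\hat y)=\begin{cases}\displaystyle\sum_{j\in\mathbb{Z}}\frac{1}{|\hat x-\rho_j(\hat y)|^q}, & q>1,\\[2ex] \displaystyle\frac1{|\hat x-\hat y|}+\sum_{j\ne 0}\Big(\frac1{|\hat x-\rho_j(\hat y)|}-\frac1{|2tj|}\Big)+\frac{\gamma-\log(4t)}{t}, & q=1,\end{cases}$$ where $\gamma$ is Euler's constant. When $K\subset S(t)$, the strip energy is $E_K(t)=\min_\mu\int_K\int_K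 G_t(\hat x,\hat y)\,d\mu(\hat x)\,d\mu(\hat y)$, the minimum again being over Borel probability measures on $K$. **Theorem.** Let $K\subset\mathbb{R}^{n+1}$ be compact with $V_q(K)<\infty$. Then there is a unique Borel probability measure $\mu_\infty$ on $K$ attaining $V_q(K)$ (the Riesz $q$-equilibrium measure of $K$); for all sufficiently large $t$ one has $K\subset S(t)$, and the minimum defining $E_K(t)$ is attained and finite; and, as $t\to\infty$, $$E_K(t)=V_q(K)+\frac{A_q(t)}{(2t)^q}-\frac{1}{(2t)^{q+2}}\left(B_q\,M_q(K)-C_q\Big(\int_K z\,d\mu_\infty(\hat x)\Big)^{2}\right)+o\!\left(\frac1{t^{q+2}}\right),$$ where $$A_q(t)=\begin{cases}2\zeta(q), & q>1,\\ 2(\gamma-\log(4t)), & q=1,\end{cases}\qquad B_q=q\,\zeta(q+2),\qquad C_q=2q(q+1)\sum_{j\in\mathbb{Z},\ j\text{ odd}}\frac1{|j|^{q+2}},$$ $$M_q(K)=\int_K\!\int_K\big(|x-y|^2-(q+1)(z-w)^2\big)\,d\mu_\infty(\hat x)\,d\mu_\infty(\hat y).$$ -/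

import Mathlib

open MeasureTheory Filter Topology Asymptotics
open scoped ENNReal

noncomputable section

namespace StripEnergy

/-- The space `ℝ^{n+1} = ℝ^n × ℝ` with its Euclidean metric. -/
abbrev Space (n : ℕ) : Type := EuclideanSpace ℝ (Fin (n + 1))

/-- The vertical coordinate `z` of the point `(x, z)`: the last one. -/
def height {n : ℕ} (p : Space n) : ℝ := p (Fin.last n)

/-- The squared distance `|x - y|²` in `ℝ^n` between the horizontal parts of `(x, z)` and
`(y, w)`. -/
def horizDistSq {n : ℕ} (p p' : Space n) : ℝ :=
  ∑ i : Fin n, (p i.castSucc - p' i.castSucc) ^ 2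

/-- The open strip `ℝ^n × (-t, t)`. -/
def strip (n : ℕ) (t : ℝ) : Set (Space n) := {p | -t < height p ∧ height p < t}

/-- The transformation `ρ_j (y, w) = (y, 2tj + (-1)^j w)`. -/
def rho {n : ℕ} (t : ℝ) (j : ℤ) (p : Space n) : Space n :=
  WithLp.toLp 2
    (Function.update (fun i => p i) (Fin.last n) (2 * t * (j : ℝ) + (-1 : ℝ) ^ j * height p))

/-- The Riesz kernel `1 / |p - p'|^q`, equal to `+∞` on the diagonal. -/
def rieszKernel {n : ℕ} (q : ℝ) (p p' : Space n) : EReal :=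
  open Classical in
  if p = p' then ⊤ else ((1 / dist p p' ^ q : ℝ) : EReal)

/-- The Neumann strip kernel `G_t` of exponent `q ≥ 1` on the strip of thickness `2t`: for `q > 1`
it is `∑_{j ∈ ℤ} 1 / |p - ρ_j p'|^q`, and for `q = 1` it is the renormalized sum
`1 / |p - p'| + ∑_{j ≠ 0} (1 / |p - ρ_j p'| - 1 / |2tj|) + (γ - log (4t)) / t`. It equals `+∞`
where a summand is infinite (in the open strip: on the diagonal). -/
def stripKernel {n : ℕ} (q t : ℝ) (p p' : Space n) : EReal :=
  open Classical in
  if ∃ j : ℤ, p = rho t j p' then ⊤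
  else if q = 1 then
    ((1 / dist p p'
      + ∑' j : {j : ℤ // j ≠ 0}, (1 / dist p (rho t j p') - 1 / |2 * t * ((j : ℤ) : ℝ)|)
      + 1 / t * (Real.eulerMascheroniConstant - Real.log (4 * t)) : ℝ) : EReal)
  else ((∑' j : ℤ, 1 / dist p (rho t j p') ^ q : ℝ) : EReal)

/-- The energy `∫∫ G(p, p') dμ(p) dμ(p')` of a measure for an extended real valued kernel, as the
integral of the positive part minus the integral of the negative part. (For the Riesz kernel the
negative part vanishes; for the strip kernel it is bounded on compact subsets of the strip.) -/
def energyIntegral {n : ℕ} (G : Space n → Space n → EReal) (μ : Measure (Space n)) : EReal :=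
  ((∫⁻ p, ∫⁻ p', (G p p').toENNReal ∂μ ∂μ : ℝ≥0∞) : EReal)
    - ((∫⁻ p, ∫⁻ p', (-(G p p')).toENNReal ∂μ ∂μ : ℝ≥0∞) : EReal)

/-- The Borel probability measures on `K`. -/
def probOn {n : ℕ} (K : Set (Space n)) : Set (Measure (Space n)) :=
  {μ | IsProbabilityMeasure μ ∧ μ Kᶜ = 0}

/-- The least energy of a probability measure on `K`; it is `+∞` when `K` is empty. -/
def kernelEnergy {n : ℕ} (G : Space n → Space n → EReal) (K : Set (Space n)) : EReal :=
  ⨅ μ ∈ probOn K, energyIntegral G μ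

/-- `μ` is an equilibrium measure of `K` for the kernel `G`: a probability measure on `K` at which
the least energy is attained. -/
def IsEquilibrium {n : ℕ} (G : Space n → Space n → EReal) (K : Set (Space n))
    (μ : Measure (Space n)) : Prop :=
  μ ∈ probOn K ∧ energyIntegral G μ = kernelEnergy G K

/-- The Riesz `q`-energy `V_q(K) = E_K(∞)`. -/
def rieszEnergy {n : ℕ} (q : ℝ) (K : Set (Space n)) : EReal := kernelEnergy (rieszKernel q) K

/-- The Neumann strip energy `E_K(t)`, for a set `K` in the strip of thickness `2t`. -/
def stripEnergy {n : ℕ} (q t : ℝ) (K : Set (Space n)) : EReal := kernelEnergy (stripKernel q t) K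

/-- `A_q(t)`, which is `2 ζ(q)` for `q > 1` and `2 (γ - log (4t))` for `q = 1`. -/
def coeffA (q t : ℝ) : ℝ :=
  open Classical in
  if q = 1 then 2 * (Real.eulerMascheroniConstant - Real.log (4 * t))
  else 2 * (riemannZeta (q : ℂ)).re

/-- `B_q = q ζ(q + 2)`. -/
def coeffB (q : ℝ) : ℝ := q * (riemannZeta ((q + 2 : ℝ) : ℂ)).re

/-- `C_q = 2 q (q + 1) ∑ 1 / |j|^(q + 2)`, the sum being over all odd integers, of both signs. -/
def coeffC (q : ℝ) : ℝ :=
  2 * q * (q + 1) * ∑' j : {j : ℤ // Odd j}, 1 / |((j : ℤ) : ℝ)| ^ (q + 2)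

/-- `M_q(K) = ∫∫ (|x - y|² - (q + 1) (z - w)²) dμ dμ`, for `μ` the equilibrium measure of `K`. -/
def secondMoment {n : ℕ} (q : ℝ) (μ : Measure (Space n)) : ℝ :=
  ∫ p, ∫ p', (horizDistSq p p' - (q + 1) * (height p - height p') ^ 2) ∂μ ∂μ

/-- Sanity check: `2 ζ(s) = ∑_{j ≠ 0} 1 / |j|^s` for real `s > 1`. -/
theorem two_zeta_eq {s : ℝ} (hs : 1 < s) :
    2 * (riemannZeta (s : ℂ)).re = ∑' j : {j : ℤ // j ≠ 0}, 1 / |((j : ℤ) : ℝ)| ^ s := by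
  have hz : (riemannZeta (s : ℂ)).re = ∑' k : ℕ, 1 / (k : ℝ) ^ s := by
    rw [zeta_eq_tsum_one_div_nat_cpow (by simpa using hs)]
    have h : ∀ k : ℕ, (1 : ℂ) / (k : ℂ) ^ (s : ℂ) = ((1 / (k : ℝ) ^ s : ℝ) : ℂ) := by
      intro k
      rw [Complex.ofReal_div, Complex.ofReal_cpow (Nat.cast_nonneg k)]
      simp
    simp_rw [h]
    rw [← Complex.ofReal_tsum, Complex.ofReal_re]
  have h0 : (1 : ℝ) / |((0 : ℤ) : ℝ)| ^ s = 0 := by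
    simp [Real.zero_rpow (by linarith : s ≠ 0)]
  have hsub : Function.support (fun j : ℤ => (1 : ℝ) / |(j : ℝ)| ^ s) ⊆ {j : ℤ | j ≠ 0} := by
    intro j hj hj0
    subst hj0
    exact hj h0
  have e := tsum_subtype_eq_of_support_subset hsub
  have hs1 : Summable fun k : ℕ => (1 : ℝ) / |((k : ℤ) : ℝ)| ^ s := by
    simpa using Real.summable_one_div_nat_rpow.2 hs
  have hs2 : Summable fun k : ℕ => (1 : ℝ) / |((-(k : ℤ) : ℤ) : ℝ)| ^ s := by
    simpa using Real.summable_one_div_nat_rpow.2 hs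
  have e2 := Summable.tsum_of_nat_of_neg (f := fun j : ℤ => (1 : ℝ) / |(j : ℝ)| ^ s) hs1 hs2
  refine Eq.trans ?_ e.symm
  rw [e2, h0, hz]
  simp
  ring

end StripEnergy

end

noncomputable section

namespace StripEnergy

/-! On a bounded set and for large `t` the strip kernel is the Riesz kernel plus a continuous
remainder, `stripRemainder`, coming from the images `ρ_j` with `j ≠ 0`. Expanding `1 / |p - ρ_j
p'|^q` in powers of `1 / (2tj)` and summing over `j`, the order zero terms give `A_q(t) / (2t)^q`
(this includes the renormalizing constant when `q = 1`). The first order terms are odd in `j` and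
cancel, and the second order terms give `quadKernel / (2t)^(q+2)`. The odd images see `z + w`
instead of `z - w`, and `(z + w)² = (z - w)² + 4zw` is the source of the `C_q` term. The error is
uniform on bounded sets: `stripRemainder_expansion`.

Passing from kernels to least energies is a perturbation argument, `min_pairEnergy_expansion`.
Testing with the Riesz minimizer `μ₀` bounds the strip energy from above. For the lower bound, the
strip minimizers nearly minimize the Riesz energy, because the leading part of the remainder does
not depend on the measure. They therefore converge weakly to `μ₀`, and the continuous quadratic
functional takes nearly the same value on them as on `μ₀`. Since `μ₀` minimizes the Riesz energy, no
rate of convergence is needed.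

Weak convergence rests on uniqueness of `μ₀`, hence on strict convexity of the Riesz energy
(`rieszEnergyE_midpoint_lt`). The Riesz kernel is a positive mixture of Gaussians, and the Gaussian
energy of `μ - ν` is a weighted `L²` norm of the difference of characteristic functions. Existence
of minimizers is lower semicontinuity on the weakly compact space of probability measures on `K`. -/

/-! ### Strict positive definiteness of Gaussian kernels -/

open ProbabilityTheory in
instance isOpenPosMeasure_stdGaussian {n : ℕ} : (stdGaussian (Space n)).IsOpenPosMeasure := by
  have h : (gaussianReal 0 1).IsOpenPosMeasure :=
    (gaussianReal_absolutelyContinuous' 0 one_ne_zero).isOpenPosMeasure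
  rw [← map_pi_eq_stdGaussian]
  exact (PiLp.continuous_toLp 2 _).isOpenPosMeasure_map (WithLp.toLp_surjective 2)

theorem continuous_charFun_of_isFiniteMeasure {n : ℕ} (μ : Measure (Space n)) [IsFiniteMeasure μ] :
    Continuous (charFun μ) := by
  unfold charFun
  refine continuous_of_dominated (bound := fun _ => 1) (fun t => ?_) (fun t => ?_) ?_ ?_
  · exact Continuous.aestronglyMeasurable (by fun_prop)
  · refine ae_of_all _ fun x => ?_
    rw [Complex.norm_exp_ofReal_mul_I]
  · exact integrable_const _
  · exact ae_of_all _ fun x => by fun_prop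

/-- The mutual energy of two measures for a Gaussian kernel. -/
def gaussEnergy {n : ℕ} (s : ℝ) (μ ν : Measure (Space n)) : ℝ :=
  ∫ z, Real.exp (-(s * ‖z.1 - z.2‖ ^ 2)) ∂(μ.prod ν)

theorem integrable_gauss {n : ℕ} {s : ℝ} (hs : 0 ≤ s) (ρ : Measure (Space n × Space n))
    [IsFiniteMeasure ρ] :
    Integrable (fun z : Space n × Space n => Real.exp (-(s * ‖z.1 - z.2‖ ^ 2))) ρ := by
  refine Integrable.of_bound (C := 1) (Continuous.aestronglyMeasurable (by fun_prop)) ?_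
  refine ae_of_all _ fun z => ?_
  rw [Real.norm_eq_abs, abs_of_pos (Real.exp_pos _), Real.exp_le_one_iff]
  have := mul_nonneg hs (sq_nonneg ‖z.1 - z.2‖)
  linarith

-- A Gaussian is its own Fourier transform up to scaling: `exp (-s |u|²)` is the characteristic
-- function of the standard Gaussian at `√(2s) u`. Fubini then separates the two variables.
open ProbabilityTheory ComplexConjugate in
theorem gaussEnergy_eq_integral_charFun {n : ℕ} {s : ℝ} (hs : 0 ≤ s) (μ ν : Measure (Space n))
    [IsFiniteMeasure μ] [IsFiniteMeasure ν] :
    (gaussEnergy s μ ν : ℂ) =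
      ∫ ξ, charFun μ (√(2 * s) • ξ) * conj (charFun ν (√(2 * s) • ξ)) ∂(stdGaussian (Space n)) := by
  set c := √(2 * s) with hc
  have hc2 : c ^ 2 = 2 * s := Real.sq_sqrt (by positivity)
  have h1 : ∀ z : Space n × Space n, ((Real.exp (-(s * ‖z.1 - z.2‖ ^ 2)) : ℝ) : ℂ) =
      ∫ ξ, Complex.exp (inner ℝ ξ (c • (z.1 - z.2)) * Complex.I) ∂(stdGaussian (Space n)) := by
    intro z
    rw [← charFun_apply, charFun_stdGaussian, norm_smul]
    push_cast
    congr 1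
    rw [mul_pow, Real.norm_eq_abs, ← Complex.ofReal_pow |c|, sq_abs, hc2]
    push_cast
    ring
  have h2 : ∀ ξ : Space n, charFun μ (c • ξ) * conj (charFun ν (c • ξ)) =
      ∫ z, Complex.exp (inner ℝ ξ (c • (z.1 - z.2)) * Complex.I) ∂(μ.prod ν) := by
    intro ξ
    rw [← charFun_neg, charFun_apply, charFun_apply, ← integral_prod_mul]
    refine integral_congr_ae (ae_of_all _ fun z => ?_)
    simp only
    rw [← Complex.exp_add]
    congr 1
    simp only [inner_smul_right, inner_neg_right, inner_sub_right, real_inner_comm ξ]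
    push_cast
    ring
  simp_rw [h2]
  rw [gaussEnergy, ← integral_complex_ofReal]
  simp_rw [h1]
  rw [integral_integral_swap]
  refine Integrable.of_bound (C := 1) (Continuous.aestronglyMeasurable (by fun_prop)) ?_
  refine ae_of_all _ fun z => ?_
  simp only [Function.uncurry]
  rw [Complex.norm_exp_ofReal_mul_I]

-- The difference of the two sides is the Gaussian integral of `|μ̂ - ν̂|²` at scaled frequencies,
-- and characteristic functions determine finite measures.
open ProbabilityTheory ComplexConjugate in
theorem gaussEnergy_add_lt {n : ℕ} {s : ℝ} (hs : 0 < s) {μ ν : Measure (Space n)}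
    [IsFiniteMeasure μ] [IsFiniteMeasure ν] (hne : μ ≠ ν) :
    gaussEnergy s μ ν + gaussEnergy s ν μ < gaussEnergy s μ μ + gaussEnergy s ν ν := by
  set c := √(2 * s) with hc
  have hc0 : c ≠ 0 := (Real.sqrt_pos.2 (by positivity)).ne'
  set f : Space n → ℂ := fun ξ => charFun μ (c • ξ) - charFun ν (c • ξ) with hf
  have hcμ := continuous_charFun_of_isFiniteMeasure μ
  have hcν := continuous_charFun_of_isFiniteMeasure ν
  have hcont : Continuous fun ξ => ‖f ξ‖ ^ 2 := by fun_prop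
  have hint : ∀ (α β : Measure (Space n)) [IsFiniteMeasure α] [IsFiniteMeasure β],
      Integrable (fun ξ => charFun α (c • ξ) * conj (charFun β (c • ξ)))
        (stdGaussian (Space n)) := by
    intro α β _ _
    have hα := continuous_charFun_of_isFiniteMeasure α
    have hβ := continuous_charFun_of_isFiniteMeasure β
    refine Integrable.of_bound (C := α.real Set.univ * β.real Set.univ)
      (Continuous.aestronglyMeasurable (by fun_prop)) (ae_of_all _ fun ξ => ?_)
    rw [norm_mul, RCLike.norm_conj]
    gcongr <;> exact norm_charFun_le _
  have hkey : ((gaussEnergy s μ μ + gaussEnergy s ν ν - gaussEnergy s μ ν - gaussEnergy s ν μ : ℝ) : ℂ)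
      = ((∫ ξ, ‖f ξ‖ ^ 2 ∂(stdGaussian (Space n)) : ℝ) : ℂ) := by
    have hpt : ∀ ξ, ((‖f ξ‖ ^ 2 : ℝ) : ℂ) = charFun μ (c • ξ) * conj (charFun μ (c • ξ))
        + charFun ν (c • ξ) * conj (charFun ν (c • ξ)) - charFun μ (c • ξ) * conj (charFun ν (c • ξ))
        - charFun ν (c • ξ) * conj (charFun μ (c • ξ)) := by
      intro ξ
      push_cast
      rw [← Complex.mul_conj', map_sub]
      ring
    rw [← integral_complex_ofReal]
    simp_rw [hpt]
    push_cast
    rw [gaussEnergy_eq_integral_charFun hs.le, gaussEnergy_eq_integral_charFun hs.le,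
      gaussEnergy_eq_integral_charFun hs.le, gaussEnergy_eq_integral_charFun hs.le,
      integral_sub, integral_sub, integral_add (hint _ _) (hint _ _)]
    · exact (hint μ μ).add (hint ν ν)
    · exact hint _ _
    · exact ((hint μ μ).add (hint ν ν)).sub (hint μ ν)
    · exact hint _ _
  have hkey' := Complex.ofReal_injective hkey
  have hfint : Integrable (fun ξ => ‖f ξ‖ ^ 2) (stdGaussian (Space n)) := by
    refine Integrable.of_bound (C := (μ.real Set.univ + ν.real Set.univ) ^ 2)
      hcont.aestronglyMeasurable (ae_of_all _ fun ξ => ?_)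
    rw [Real.norm_eq_abs, abs_of_nonneg (by positivity)]
    gcongr
    exact (norm_sub_le _ _).trans (add_le_add (norm_charFun_le _) (norm_charFun_le _))
  have hpos : 0 < ∫ ξ, ‖f ξ‖ ^ 2 ∂(stdGaussian (Space n)) := by
    have h : ∃ t, charFun μ t ≠ charFun ν t := by
      by_contra! h
      exact hne (Measure.ext_of_charFun (funext h))
    obtain ⟨t, ht⟩ := h
    -- The standard Gaussian charges every nonempty open set, so one frequency where the continuous
    -- integrand is nonzero is enough.
    refine integral_pos_of_integrable_nonneg_nonzero hcont hfint (fun ξ => by positivity)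
      (x := c⁻¹ • t) ?_
    have : f (c⁻¹ • t) ≠ 0 := by
      simp only [hf]
      rw [smul_smul, mul_inv_cancel₀ hc0, one_smul]
      exact sub_ne_zero.2 ht
    simpa using this
  linarith

/-! ### The Riesz kernel as a mixture of Gaussians, and strict convexity -/

/-- The Riesz kernel, with values in `[0, ∞]`. -/
def rieszE {n : ℕ} (q : ℝ) (z : Space n × Space n) : ℝ≥0∞ := edist z.1 z.2 ^ (-q)

/-- The Riesz energy, with values in `[0, ∞]`. -/
def rieszEnergyE {n : ℕ} (q : ℝ) (μ : Measure (Space n)) : ℝ≥0∞ :=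
  ∫⁻ z, rieszE q z ∂(μ.prod μ)

/-- This is Euler's Gamma integral. The case `r = 0` is included, with both sides infinite, because
no power is integrable on the whole half-line; the diagonal then needs no separate treatment. -/
theorem lintegral_rpow_mul_exp {a r : ℝ} (ha : 0 < a) (hr : 0 ≤ r) :
    ∫⁻ s in Set.Ioi (0 : ℝ), ENNReal.ofReal (s ^ (a - 1) * Real.exp (-(s * r))) =
      ENNReal.ofReal (Real.Gamma a) * ENNReal.ofReal r ^ (-a) := by
  have hmeas : AEStronglyMeasurable (fun s : ℝ => s ^ (a - 1) * Real.exp (-(s * r)))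
      (volume.restrict (Set.Ioi 0)) := Measurable.aestronglyMeasurable (by fun_prop)
  have hnn : 0 ≤ᵐ[volume.restrict (Set.Ioi 0)] fun s : ℝ => s ^ (a - 1) * Real.exp (-(s * r)) := by
    filter_upwards [ae_restrict_mem measurableSet_Ioi] with s hs
    have : (0 : ℝ) < s := hs
    simp only [Pi.zero_apply]
    positivity
  rcases hr.eq_or_lt with rfl | hr
  · rw [ENNReal.ofReal_zero, ENNReal.zero_rpow_of_neg (by linarith), ENNReal.mul_top
      (by simpa using Real.Gamma_pos_of_pos ha)]
    by_contra h
    have hi := (lintegral_ofReal_ne_top_iff_integrable hmeas hnn).1 h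
    refine not_integrableOn_Ioi_rpow (a - 1) ?_
    simpa [IntegrableOn] using hi
  · have h := Real.integral_rpow_mul_exp_neg_mul_Ioi ha hr
    simp_rw [mul_comm r] at h
    have hi : IntegrableOn (fun s : ℝ => s ^ (a - 1) * Real.exp (-(s * r))) (Set.Ioi 0) := by
      refine .of_integral_ne_zero ?_
      rw [h]
      have := Real.Gamma_pos_of_pos ha
      positivity
    rw [← ofReal_integral_eq_lintegral_ofReal hi hnn, h, ENNReal.ofReal_rpow_of_pos hr,
      ← ENNReal.ofReal_mul (Real.Gamma_pos_of_pos ha).le, one_div, Real.inv_rpow hr.le,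
      Real.rpow_neg hr.le, mul_comm]

theorem gamma_mul_rieszE {n : ℕ} {q : ℝ} (hq : 0 < q) (z : Space n × Space n) :
    ENNReal.ofReal (Real.Gamma (q / 2)) * rieszE q z =
      ∫⁻ s in Set.Ioi (0 : ℝ), ENNReal.ofReal (s ^ (q / 2 - 1)) *
        ENNReal.ofReal (Real.exp (-(s * ‖z.1 - z.2‖ ^ 2))) := by
  have h := lintegral_rpow_mul_exp (a := q / 2) (r := ‖z.1 - z.2‖ ^ 2) (by positivity)
    (by positivity)
  rw [rieszE, edist_dist, dist_eq_norm]
  have h2 : ENNReal.ofReal (‖z.1 - z.2‖ ^ 2) ^ (-(q / 2)) =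
      ENNReal.ofReal ‖z.1 - z.2‖ ^ (-q) := by
    rw [ENNReal.ofReal_pow (norm_nonneg _), ← ENNReal.rpow_natCast, ← ENNReal.rpow_mul]
    congr 1
    push_cast
    ring
  rw [← h2, ← h]
  refine setLIntegral_congr_fun measurableSet_Ioi fun s hs => ?_
  rw [ENNReal.ofReal_mul (Real.rpow_nonneg (le_of_lt hs) _)]

theorem gamma_mul_lintegral_rieszE {n : ℕ} {q : ℝ} (hq : 0 < q) (μ ν : Measure (Space n))
    [IsFiniteMeasure μ] [IsFiniteMeasure ν] :
    ENNReal.ofReal (Real.Gamma (q / 2)) * ∫⁻ z, rieszE q z ∂(μ.prod ν) =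
      ∫⁻ s in Set.Ioi (0 : ℝ), ENNReal.ofReal (s ^ (q / 2 - 1)) *
        ENNReal.ofReal (gaussEnergy s μ ν) := by
  rw [← lintegral_const_mul' _ _ ENNReal.ofReal_ne_top]
  simp_rw [gamma_mul_rieszE hq]
  rw [lintegral_lintegral_swap (Measurable.aemeasurable (by unfold Function.uncurry; fun_prop))]
  refine setLIntegral_congr_fun measurableSet_Ioi fun s hs => ?_
  rw [lintegral_const_mul' _ _ ENNReal.ofReal_ne_top, gaussEnergy,
    ofReal_integral_eq_lintegral_ofReal (integrable_gauss (le_of_lt hs) _)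
      (ae_of_all _ fun z => (Real.exp_pos _).le)]

theorem gaussEnergy_nonneg {n : ℕ} (s : ℝ) (μ ν : Measure (Space n)) : 0 ≤ gaussEnergy s μ ν :=
  integral_nonneg fun _ => (Real.exp_pos _).le

theorem gaussEnergy_midpoint {n : ℕ} {s : ℝ} (hs : 0 ≤ s) (μ ν : Measure (Space n))
    [IsFiniteMeasure μ] [IsFiniteMeasure ν] :
    gaussEnergy s ((2⁻¹ : ℝ≥0∞) • (μ + ν)) ((2⁻¹ : ℝ≥0∞) • (μ + ν)) =
      (gaussEnergy s μ μ + gaussEnergy s μ ν + (gaussEnergy s ν μ + gaussEnergy s ν ν)) / 4 := by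
  unfold gaussEnergy
  rw [Measure.prod_smul_left, Measure.prod_smul_right, integral_smul_measure,
    integral_smul_measure, Measure.prod_add, Measure.add_prod, Measure.add_prod,
    integral_add_measure, integral_add_measure, integral_add_measure]
  · simp only [ENNReal.toReal_inv, ENNReal.toReal_ofNat, smul_eq_mul]
    ring
  all_goals exact integrable_gauss hs _

theorem measurable_gaussEnergy {n : ℕ} (μ ν : Measure (Space n))
    [IsFiniteMeasure μ] [IsFiniteMeasure ν] : Measurable fun s => gaussEnergy s μ ν := by
  unfold gaussEnergy
  refine (StronglyMeasurable.integral_prod_right'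
    (f := fun p : ℝ × (Space n × Space n) => Real.exp (-(p.1 * ‖p.2.1 - p.2.2‖ ^ 2))) ?_).measurable
  exact Continuous.stronglyMeasurable (by fun_prop)

/-- Strict convexity of the Riesz energy. -/
theorem rieszEnergyE_midpoint_lt {n : ℕ} {q : ℝ} (hq : 0 < q) {μ ν : Measure (Space n)}
    [IsFiniteMeasure μ] [IsFiniteMeasure ν] (hne : μ ≠ ν)
    (hfin : rieszEnergyE q μ ≠ ⊤) (heq : rieszEnergyE q ν = rieszEnergyE q μ) :
    rieszEnergyE q ((2⁻¹ : ℝ≥0∞) • (μ + ν)) < rieszEnergyE q μ := by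
  have hΓ := Real.Gamma_pos_of_pos (half_pos hq)
  have hfm : IsFiniteMeasure ((2⁻¹ : ℝ≥0∞) • (μ + ν)) := by
    refine ⟨?_⟩
    simp only [Measure.smul_apply, Measure.add_apply, smul_eq_mul]
    exact ENNReal.mul_lt_top (by simp) (by simp)
  have hμ := gamma_mul_lintegral_rieszE hq μ μ
  have hν := gamma_mul_lintegral_rieszE hq ν ν
  have hm := gamma_mul_lintegral_rieszE hq ((2⁻¹ : ℝ≥0∞) • (μ + ν)) ((2⁻¹ : ℝ≥0∞) • (μ + ν))
  set m := (2⁻¹ : ℝ≥0∞) • (μ + ν) with hmdef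
  have mμ := measurable_gaussEnergy μ μ
  have mν := measurable_gaussEnergy ν ν
  have hsum : ∫⁻ s in Set.Ioi (0 : ℝ), (ENNReal.ofReal (s ^ (q / 2 - 1)) *
        ENNReal.ofReal (gaussEnergy s μ μ) + ENNReal.ofReal (s ^ (q / 2 - 1)) *
        ENNReal.ofReal (gaussEnergy s ν ν)) =
      2 * (ENNReal.ofReal (Real.Gamma (q / 2)) * rieszEnergyE q μ) := by
    rw [lintegral_add_left (by fun_prop), ← hμ, ← hν]
    change _ * rieszEnergyE q μ + _ * rieszEnergyE q ν = _
    rw [heq, two_mul]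
  have hlt : ∀ s ∈ Set.Ioi (0 : ℝ), 2 * (ENNReal.ofReal (s ^ (q / 2 - 1)) *
        ENNReal.ofReal (gaussEnergy s m m)) < ENNReal.ofReal (s ^ (q / 2 - 1)) *
        ENNReal.ofReal (gaussEnergy s μ μ) + ENNReal.ofReal (s ^ (q / 2 - 1)) *
        ENNReal.ofReal (gaussEnergy s ν ν) := by
    intro s hs
    have hs' : (0 : ℝ) < s := hs
    have h0 : 0 < s ^ (q / 2 - 1) := Real.rpow_pos_of_pos hs' _
    have h1 := gaussEnergy_add_lt hs' hne
    rw [hmdef, gaussEnergy_midpoint hs'.le, ← ENNReal.ofReal_mul h0.le, ← ENNReal.ofReal_mul h0.le,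
      ← ENNReal.ofReal_mul h0.le, ← ENNReal.ofReal_add, ← ENNReal.ofReal_ofNat 2,
      ← ENNReal.ofReal_mul zero_le_two]
    -- Four times the midpoint energy is the sum of all four energies, and the two mutual energies
    -- add up to less than the two self-energies.
    · have a1 := gaussEnergy_nonneg s μ μ
      have a2 := gaussEnergy_nonneg s ν ν
      have a3 := gaussEnergy_nonneg s μ ν
      have a4 := gaussEnergy_nonneg s ν μ
      rw [ENNReal.ofReal_lt_ofReal_iff_of_nonneg (by positivity)]
      nlinarith
    · exact mul_nonneg h0.le (gaussEnergy_nonneg _ _ _)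
    · exact mul_nonneg h0.le (gaussEnergy_nonneg _ _ _)
  have hΓtop : 2 * (ENNReal.ofReal (Real.Gamma (q / 2)) * rieszEnergyE q μ) ≠ ⊤ :=
    ENNReal.mul_ne_top (by simp) (ENNReal.mul_ne_top ENNReal.ofReal_ne_top hfin)
  have hle : ∫⁻ s in Set.Ioi (0 : ℝ), 2 * (ENNReal.ofReal (s ^ (q / 2 - 1)) *
      ENNReal.ofReal (gaussEnergy s m m)) ≠ ⊤ :=
    ne_top_of_le_ne_top hΓtop (hsum ▸ setLIntegral_mono' measurableSet_Ioi fun s hs => (hlt s hs).le)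
  -- A pointwise strict inequality survives integration because the smaller integral is finite.
  have h := setLIntegral_strict_mono measurableSet_Ioi (by simp)
    (by fun_prop) hle (ae_of_all _ hlt)
  rw [lintegral_const_mul' _ _ (by simp), ← hm, hsum] at h
  change 2 * (_ * rieszEnergyE q m) < _ at h
  rw [← mul_assoc, ← mul_assoc] at h
  exact lt_of_mul_lt_mul_left' h

/-! ### Minimizing energies on a compact space, and perturbing the kernel -/

/-- The energy of a probability measure for a kernel with values in `[0, ∞]`. -/
def pairEnergy {X : Type*} [MeasurableSpace X] (k : X × X → ℝ≥0∞) (μ : ProbabilityMeasure X) :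
    ℝ≥0∞ :=
  ∫⁻ z, k z ∂((μ : Measure X).prod μ)

theorem continuous_integral_prod_self {X : Type*} [MetricSpace X] [CompactSpace X]
    [MeasurableSpace X] [BorelSpace X] {f : X × X → ℝ} (hf : Continuous f) :
    Continuous fun μ : ProbabilityMeasure X => ∫ z, f z ∂((μ : Measure X).prod μ) := by
  have h1 : Continuous fun μ : ProbabilityMeasure X => μ.prod μ :=
    ProbabilityMeasure.continuous_prod.comp (continuous_id.prodMk continuous_id)
  have h2 := ProbabilityMeasure.continuous_integral_boundedContinuousFunction (X := X × X)
    (BoundedContinuousFunction.mkOfCompact ⟨f, hf⟩)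
  exact h2.comp h1

/-- By monotone convergence the energy is the supremum of the energies of the truncations `min k m`,
each of which is bounded, continuous, and so weakly continuous in the measure. -/
theorem lowerSemicontinuous_pairEnergy {X : Type*} [MetricSpace X] [CompactSpace X]
    [MeasurableSpace X] [BorelSpace X] {k : X × X → ℝ≥0∞} (hk : Continuous k) :
    LowerSemicontinuous (pairEnergy k) := by
  have hsup : ∀ z, k z = ⨆ m : ℕ, min (k z) m := by
    intro z
    rw [← inf_iSup_eq, ENNReal.iSup_natCast, inf_top_eq]
  have hc : ∀ m : ℕ, Continuous fun z => min (k z) (m : ℝ≥0∞) := fun m => hk.min continuous_const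
  have htop : ∀ (m : ℕ) z, min (k z) (m : ℝ≥0∞) ≠ ⊤ := fun m z =>
    ne_top_of_le_ne_top (ENNReal.natCast_ne_top m) (min_le_right _ _)
  have h : pairEnergy k = fun μ : ProbabilityMeasure X =>
      ⨆ m : ℕ, ENNReal.ofReal (∫ z, (min (k z) m).toReal ∂((μ : Measure X).prod μ)) := by
    funext μ
    have : pairEnergy k μ = ∫⁻ z, ⨆ m : ℕ, min (k z) m ∂((μ : Measure X).prod μ) :=
      lintegral_congr hsup
    rw [this, lintegral_iSup (fun m => (hc m).measurable)]
    · refine iSup_congr fun m => ?_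
      rw [ofReal_integral_eq_lintegral_ofReal]
      · exact lintegral_congr fun z => (ENNReal.ofReal_toReal (htop m z)).symm
      · refine Integrable.of_bound (C := m) (hc m).measurable.ennreal_toReal.aestronglyMeasurable
          (ae_of_all _ fun z => ?_)
        rw [Real.norm_eq_abs, abs_of_nonneg ENNReal.toReal_nonneg]
        exact ENNReal.toReal_le_of_le_ofReal (by positivity) (by simp)
      · exact ae_of_all _ fun z => ENNReal.toReal_nonneg
    · intro i j hij z
      exact min_le_min le_rfl (by exact_mod_cast hij)
  rw [h]
  refine lowerSemicontinuous_iSup fun m => Continuous.lowerSemicontinuous ?_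
  refine ENNReal.continuous_ofReal.comp (continuous_integral_prod_self ?_)
  exact continuous_iff_continuousAt.2 fun z =>
    (ENNReal.tendsto_toReal (htop m z)).comp (hc m).continuousAt

/-- The weak topology makes the probability measures on a compact space compact. The term `f`
carries the continuous part of a perturbed energy; `f = 0` serves the Riesz energy itself. -/
theorem exists_pairEnergy_add_le {X : Type*} [MetricSpace X] [CompactSpace X] [Nonempty X]
    [MeasurableSpace X] [BorelSpace X] {k : X × X → ℝ≥0∞} (hk : Continuous k)
    {f : ProbabilityMeasure X → ℝ≥0∞} (hf : Continuous f) :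
    ∃ μ, ∀ ν, pairEnergy k μ + f μ ≤ pairEnergy k ν + f ν := by
  have : Nonempty (ProbabilityMeasure X) :=
    ⟨⟨Measure.dirac (Classical.arbitrary X), inferInstance⟩⟩
  obtain ⟨μ, -, hμ⟩ := LowerSemicontinuousOn.exists_isMinOn (f := fun μ => pairEnergy k μ + f μ)
    (s := Set.univ) Set.univ_nonempty isCompact_univ
    (((lowerSemicontinuous_pairEnergy hk).add hf.lowerSemicontinuous).lowerSemicontinuousOn _)
  exact ⟨μ, fun ν => hμ (Set.mem_univ ν)⟩

/-- Minimizing sequences converge to a unique minimizer. -/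
theorem tendsto_of_unique_min {Y ι : Type*} [TopologicalSpace Y] [CompactSpace Y] {l : Filter ι}
    {J : Y → ℝ≥0∞} (hJ : LowerSemicontinuous J) {y₀ : Y} (hmin : ∀ y, y ≠ y₀ → J y₀ < J y)
    {y : ι → Y} (hy : ∀ c, J y₀ < c → ∀ᶠ i in l, J (y i) < c) : Tendsto y l (𝓝 y₀) := by
  rw [tendsto_nhds]
  intro U hU hyU
  rcases (Uᶜ).eq_empty_or_nonempty with he | hne
  · rw [Set.compl_empty_iff] at he
    simp [he]
  · obtain ⟨x, hx, hxm⟩ := LowerSemicontinuousOn.exists_isMinOn hne hU.isClosed_compl.isCompact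
      (hJ.lowerSemicontinuousOn _)
    have hx0 : x ≠ y₀ := by
      rintro rfl
      exact hx hyU
    filter_upwards [hy _ (hmin x hx0)] with i hi
    by_contra h
    exact absurd (hxm h) (not_le.2 hi)

/-- The perturbation `r` may be negative. Adding the constant `δ` to both sides keeps the identity
inside `[0, ∞]`, without subtraction and with infinite energies allowed. -/
theorem pairEnergy_add_eq {X : Type*} [MetricSpace X] [CompactSpace X]
    [MeasurableSpace X] [BorelSpace X] {k k' : X × X → ℝ≥0∞} {r : X × X → ℝ} (hr : Continuous r)
    {δ : ℝ} (hrδ : ∀ z, 0 ≤ r z + δ)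
    (hk' : ∀ z, k' z + ENNReal.ofReal δ = k z + ENNReal.ofReal (r z + δ))
    (μ : ProbabilityMeasure X) :
    pairEnergy k' μ + ENNReal.ofReal δ =
      pairEnergy k μ + ENNReal.ofReal (∫ z, r z ∂((μ : Measure X).prod μ) + δ) := by
  have hri : Integrable r ((μ : Measure X).prod μ) := by
    refine hr.integrable_of_hasCompactSupport (HasCompactSupport.of_compactSpace _)
  have h1 : pairEnergy k' μ + ENNReal.ofReal δ =
      ∫⁻ z, (k' z + ENNReal.ofReal δ) ∂((μ : Measure X).prod μ) := by
    rw [lintegral_add_right _ measurable_const]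
    simp [pairEnergy]
  have h2 : ∫ z, r z ∂((μ : Measure X).prod μ) + δ =
      ∫ z, (r z + δ) ∂((μ : Measure X).prod μ) := by
    rw [integral_add hri (integrable_const _)]
    simp
  rw [h1, h2, lintegral_congr hk', lintegral_add_right _ (by fun_prop),
    ofReal_integral_eq_lintegral_ofReal (f := fun z => r z + δ) (hri.add (integrable_const _))
      (ae_of_all _ hrδ)]
  rfl

/-- Perturbing a kernel with a unique energy minimizer: the expansion of the least energy. -/
theorem min_pairEnergy_expansion {X : Type*} [MetricSpace X] [CompactSpace X]
    [MeasurableSpace X] [BorelSpace X] {k : X × X → ℝ≥0∞} (hk : Continuous k)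
    {μ₀ : ProbabilityMeasure X} (hmin : ∀ ν, ν ≠ μ₀ → pairEnergy k μ₀ < pairEnergy k ν)
    (hfin : pairEnergy k μ₀ ≠ ⊤) {F : X × X → ℝ} (hF : Continuous F) {a b : ℝ → ℝ}
    (hb : ∀ᶠ t in atTop, 0 < b t) (hb0 : Tendsto b atTop (𝓝 0)) {r : ℝ → X × X → ℝ}
    (hr : ∀ᶠ t in atTop, Continuous (r t))
    (hexp : ∀ η > 0, ∀ᶠ t in atTop, ∀ z, |r t z - (a t + b t * F z)| ≤ η * b t)
    {k' : ℝ → X × X → ℝ≥0∞}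
    (hk' : ∀ᶠ t in atTop, ∃ δ : ℝ, 0 ≤ δ ∧ ∀ z, 0 ≤ r t z + δ ∧
      k' t z + ENNReal.ofReal δ = k z + ENNReal.ofReal (r t z + δ)) :
    (∀ᶠ t in atTop, ∃ μ, (∀ ν, pairEnergy (k' t) μ ≤ pairEnergy (k' t) ν) ∧
      pairEnergy (k' t) μ ≠ ⊤) ∧
    (fun t => (⨅ ν, pairEnergy (k' t) ν).toReal -
      ((pairEnergy k μ₀).toReal + a t + b t * ∫ z, F z ∂((μ₀ : Measure X).prod μ₀))) =o[atTop] b := by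
  have hne : Nonempty X := by
    by_contra h
    rw [not_nonempty_iff] at h
    have := measure_univ (μ := (μ₀ : Measure X))
    rw [Set.univ_eq_empty_iff.2 h] at this
    simp at this
  set R : ℝ → ProbabilityMeasure X → ℝ := fun t μ => ∫ z, r t z ∂((μ : Measure X).prod μ) with hR
  set Φ : ProbabilityMeasure X → ℝ := fun μ => ∫ z, F z ∂((μ : Measure X).prod μ) with hΦ
  set V := (pairEnergy k μ₀).toReal with hV
  have hΦc : Continuous Φ := continuous_integral_prod_self hF
  -- the real form of the perturbed energy
  have hreal : ∀ᶠ t in atTop, ∀ μ, pairEnergy k μ ≠ ⊤ → pairEnergy (k' t) μ ≠ ⊤ ∧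
      (pairEnergy (k' t) μ).toReal = (pairEnergy k μ).toReal + R t μ := by
    filter_upwards [hr, hk'] with t hrt ⟨δ, hδ, hkt⟩ μ hμ
    have h := pairEnergy_add_eq hrt (fun z => (hkt z).1) (fun z => (hkt z).2) μ
    have hRδ : 0 ≤ R t μ + δ := by
      have hri : Integrable (r t) ((μ : Measure X).prod μ) :=
        hrt.integrable_of_hasCompactSupport (HasCompactSupport.of_compactSpace _)
      have h2 : R t μ + δ = ∫ z, (r t z + δ) ∂((μ : Measure X).prod μ) := by
        rw [integral_add hri (integrable_const _)]
        simp [hR]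
      rw [h2]
      exact integral_nonneg fun z => (hkt z).1
    have hlt : pairEnergy (k' t) μ ≠ ⊤ := by
      refine ne_top_of_le_ne_top ?_ (le_self_add (b := ENNReal.ofReal δ))
      rw [h]
      exact ENNReal.add_ne_top.2 ⟨hμ, ENNReal.ofReal_ne_top⟩
    refine ⟨hlt, ?_⟩
    have h3 := congrArg ENNReal.toReal h
    rw [ENNReal.toReal_add hlt ENNReal.ofReal_ne_top, ENNReal.toReal_add hμ ENNReal.ofReal_ne_top,
      ENNReal.toReal_ofReal hδ, ENNReal.toReal_ofReal hRδ] at h3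
    linarith
  have hreal' : ∀ᶠ t in atTop, ∀ μ, pairEnergy (k' t) μ ≠ ⊤ → pairEnergy k μ ≠ ⊤ := by
    filter_upwards [hr, hk'] with t hrt ⟨δ, hδ, hkt⟩ μ hμ
    have h := pairEnergy_add_eq hrt (fun z => (hkt z).1) (fun z => (hkt z).2) μ
    refine ne_top_of_le_ne_top ?_ (le_self_add (b := ENNReal.ofReal (R t μ + δ)))
    rw [← h]
    exact ENNReal.add_ne_top.2 ⟨hμ, ENNReal.ofReal_ne_top⟩
  have hexists : ∀ᶠ t in atTop, ∃ μ, ∀ ν, pairEnergy (k' t) μ ≤ pairEnergy (k' t) ν := by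
    filter_upwards [hr, hk'] with t hrt ⟨δ, hδ, hkt⟩
    have h := pairEnergy_add_eq hrt (fun z => (hkt z).1) (fun z => (hkt z).2)
    obtain ⟨μ, hμ⟩ := exists_pairEnergy_add_le hk (f := fun μ => ENNReal.ofReal (R t μ + δ))
      (ENNReal.continuous_ofReal.comp
        ((continuous_integral_prod_self hrt).add continuous_const))
    refine ⟨μ, fun ν => ?_⟩
    have h4 := hμ ν
    rw [← h μ, ← h ν] at h4
    exact (ENNReal.add_le_add_iff_right ENNReal.ofReal_ne_top).1 h4
  have hex : ∀ᶠ t in atTop, ∃ μ, (∀ ν, pairEnergy (k' t) μ ≤ pairEnergy (k' t) ν) ∧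
      pairEnergy (k' t) μ ≠ ⊤ := by
    filter_upwards [hexists, hreal] with t ⟨μ, hμ⟩ h
    exact ⟨μ, hμ, ne_top_of_le_ne_top (h μ₀ hfin).1 (hμ μ₀)⟩
  refine ⟨hex, ?_⟩
  -- choose minimizers
  have hch : ∃ m : ℝ → ProbabilityMeasure X, ∀ᶠ t in atTop,
      (∀ ν, pairEnergy (k' t) (m t) ≤ pairEnergy (k' t) ν) ∧ pairEnergy (k' t) (m t) ≠ ⊤ := by
    classical
    refine ⟨fun t => if h : ∃ μ, (∀ ν, pairEnergy (k' t) μ ≤ pairEnergy (k' t) ν) ∧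
      pairEnergy (k' t) μ ≠ ⊤ then h.choose else μ₀, ?_⟩
    filter_upwards [hex] with t ht
    rw [dif_pos ht]
    exact ht.choose_spec
  obtain ⟨m, hm⟩ := hch
  have hRexp : ∀ η > 0, ∀ᶠ t in atTop, ∀ μ, |R t μ - (a t + b t * Φ μ)| ≤ η * b t := by
    intro η hη
    filter_upwards [hexp η hη, hr] with t ht hrt μ
    have hri : Integrable (r t) ((μ : Measure X).prod μ) :=
      hrt.integrable_of_hasCompactSupport (HasCompactSupport.of_compactSpace _)
    have hFi : Integrable F ((μ : Measure X).prod μ) :=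
      hF.integrable_of_hasCompactSupport (HasCompactSupport.of_compactSpace _)
    have h1 : R t μ - (a t + b t * Φ μ) =
        ∫ z, (r t z - (a t + b t * F z)) ∂((μ : Measure X).prod μ) := by
      have hFi' : Integrable (fun z => a t + b t * F z) ((μ : Measure X).prod μ) :=
        (integrable_const _).add (hFi.const_mul _)
      rw [integral_sub hri hFi',
        integral_add (integrable_const _) (hFi.const_mul _), integral_const_mul]
      simp [hR, hΦ]
    rw [h1, ← Real.norm_eq_abs]
    refine (norm_integral_le_of_norm_le_const (C := η * b t) (ae_of_all _ fun z => ?_)).trans ?_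
    · exact ht z
    · simp
  have hminV : ∀ ν, pairEnergy k ν ≠ ⊤ → V ≤ (pairEnergy k ν).toReal := by
    intro ν hν
    by_cases h : ν = μ₀
    · rw [h]
    · exact ENNReal.toReal_mono hν (hmin ν h).le
  obtain ⟨C, hC⟩ : ∃ C, ∀ μ, |Φ μ| ≤ C := by
    obtain ⟨C, hC⟩ := isCompact_univ.exists_bound_of_continuousOn hΦc.continuousOn
    exact ⟨C, fun μ => hC μ (Set.mem_univ μ)⟩
  have hconv : Tendsto m atTop (𝓝 μ₀) := by
    refine tendsto_of_unique_min (lowerSemicontinuous_pairEnergy hk) hmin fun c hc => ?_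
    -- Comparing the minimizer `m t` with `μ₀`, the terms `a t` cancel. What is left is at most `2 *
    -- C` from the oscillation of `Φ` plus two expansion errors with `η = 1`, all multiplied by `b
    -- t`.
    have hsmall : ∀ᶠ t in atTop, ENNReal.ofReal (V + b t * (2 * C + 2)) < c := by
      have h1 : Tendsto (fun t => ENNReal.ofReal (V + b t * (2 * C + 2))) atTop
          (𝓝 (ENNReal.ofReal (V + 0 * (2 * C + 2)))) :=
        (ENNReal.continuous_ofReal.tendsto _).comp
          (tendsto_const_nhds.add (hb0.mul tendsto_const_nhds))
      rw [zero_mul, add_zero, ENNReal.ofReal_toReal hfin] at h1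
      exact h1.eventually_lt_const hc
    filter_upwards [hsmall, hm, hreal, hreal', hRexp 1 one_pos, hb] with t h1 ⟨h2, h3⟩ h4 h5 h6 h7
    have h8 := h5 _ h3
    refine lt_of_le_of_lt ?_ h1
    rw [← ENNReal.ofReal_toReal h8]
    refine ENNReal.ofReal_le_ofReal ?_
    have h9 := ENNReal.toReal_mono (h4 μ₀ hfin).1 (h2 μ₀)
    rw [(h4 _ h8).2, (h4 _ hfin).2] at h9
    have e1 := abs_le.1 (h6 (m t))
    have e2 := abs_le.1 (h6 μ₀)
    have e3 := abs_le.1 (hC (m t))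
    have e4 := abs_le.1 (hC μ₀)
    have e5 : b t * (Φ μ₀ - Φ (m t)) ≤ b t * (2 * C) :=
      mul_le_mul_of_nonneg_left (by linarith) h7.le
    linarith
  have hΦconv : Tendsto (fun t => Φ (m t)) atTop (𝓝 (Φ μ₀)) := (hΦc.tendsto _).comp hconv
  rw [isLittleO_iff]
  intro η hη
  have hΦs : ∀ᶠ t in atTop, |Φ (m t) - Φ μ₀| < η / 2 := by
    have := (Metric.tendsto_nhds.1 hΦconv) (η / 2) (half_pos hη)
    simpa [Real.dist_eq] using this
  filter_upwards [hΦs, hm, hreal, hreal', hRexp (η / 2) (half_pos hη), hb]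
    with t h1 ⟨h2, h3⟩ h4 h5 h6 h7
  have hinf : ⨅ ν, pairEnergy (k' t) ν = pairEnergy (k' t) (m t) :=
    le_antisymm (iInf_le _ _) (le_iInf h2)
  have h8 := h5 _ h3
  have h9 := ENNReal.toReal_mono (h4 μ₀ hfin).1 (h2 μ₀)
  have h10 := hminV _ h8
  rw [hinf, Real.norm_eq_abs, Real.norm_eq_abs, abs_of_pos h7, (h4 _ h8).2]
  rw [(h4 _ h8).2, (h4 _ hfin).2] at h9
  have e1 := abs_le.1 (h6 (m t))
  have e2 := abs_le.1 (h6 μ₀)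
  have e3 := abs_lt.1 h1
  have e4 : b t * (Φ μ₀ - Φ (m t)) ≤ b t * (η / 2) :=
    mul_le_mul_of_nonneg_left (by linarith) h7.le
  change |_ - (V + a t + b t * Φ μ₀)| ≤ _
  -- The lower bound uses `V ≤ pairEnergy k (m t)` and spends half of `η` on `Φ (m t) - Φ μ₀` and
  -- half on the expansion. The upper bound tests the perturbed energy at `μ₀`.
  rw [abs_le]
  constructor <;> linarith

/-! ### Taylor expansion of an inverse power -/

/-- The derivative of the difference is `o(x)` by differentiability of `(1 + x)^(a - 1)` at `0`; the
mean value inequality then gains one order. -/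
theorem one_add_rpow_isLittleO (a : ℝ) :
    (fun x : ℝ => (1 + x) ^ a - (1 + a * x + a * (a - 1) / 2 * x ^ 2)) =o[𝓝 0] fun x => x ^ 2 := by
  have hd : ∀ b : ℝ, ∀ x > (-1 : ℝ), HasDerivAt (fun x : ℝ => (1 + x) ^ b) (b * (1 + x) ^ (b - 1)) x := by
    intro b x hx
    have h := ((hasDerivAt_id x).const_add 1).rpow_const (p := b) (Or.inl (by simp; linarith))
    simpa [mul_comm] using h
  have hs : Set.Ioi (-1 : ℝ) ∈ 𝓝 (0 : ℝ) := Ioi_mem_nhds (by norm_num)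
  have h1 : (fun x : ℝ => a * (1 + x) ^ (a - 1) - a - a * (a - 1) * x) =o[𝓝[Set.Ioi (-1)] 0]
      fun x => (x - 0) ^ 1 := by
    have h := ((hd (a - 1) 0 (by norm_num)).const_mul a).isLittleO
    rw [nhdsWithin_eq_nhds.2 hs]
    refine h.congr (fun x => ?_) (fun x => by simp)
    simp
    ring
  have h2 := Convex.isLittleO_pow_succ_real (n := 1) (convex_Ioi (-1 : ℝ)) (x₀ := 0)
    (f := fun x : ℝ => (1 + x) ^ a - (1 + a * x + a * (a - 1) / 2 * x ^ 2))
    (f' := fun x : ℝ => a * (1 + x) ^ (a - 1) - a - a * (a - 1) * x) (by simp) (fun x hx => by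
      have h := (hd a x hx).sub ((((hasDerivAt_id x).const_mul a).const_add 1).add
        ((hasDerivAt_pow 2 x).const_mul (a * (a - 1) / 2)))
      refine (h.congr_deriv ?_).hasDerivWithinAt
      simp
      ring) h1
  rw [nhdsWithin_eq_nhds.2 hs] at h2
  simpa using h2

/-- Second order expansion of `(1 - 2 s ε + (s² + h) ε²)^(-q/2)` in `ε`, uniform in `s` and `h`. -/
theorem inverse_power_expansion (q S H : ℝ) {η : ℝ} (hη : 0 < η) :
    ∃ ε₀ > 0, ∀ s h ε : ℝ, |s| ≤ S → |h| ≤ H → |ε| ≤ ε₀ →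
      0 < 1 + (-2 * s * ε + (s ^ 2 + h) * ε ^ 2) ∧
      |(1 + (-2 * s * ε + (s ^ 2 + h) * ε ^ 2)) ^ (-(q / 2)) -
        (1 + q * s * ε + q / 2 * ((q + 1) * s ^ 2 - h) * ε ^ 2)| ≤ η * ε ^ 2 := by
  set S' := |S| + 1 with hS'
  set M := S' ^ 2 + |H| with hM
  set L := 2 * S' + M with hL
  set D := |q * (q + 2) / 8| * (4 * S' * M + M ^ 2) with hD
  have hS0 : 0 < S' := by positivity
  have hM0 : 0 < M := by positivity
  have hL0 : 0 < L := by positivity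
  have hD0 : 0 ≤ D := by positivity
  have hSS : S ≤ S' := (le_abs_self S).trans (by linarith)
  have hHM : S' ^ 2 + H ≤ M := by linarith [le_abs_self H]
  clear_value S' M L D
  have ht := (one_add_rpow_isLittleO (-(q / 2))).def (c := η / (2 * L ^ 2)) (by positivity)
  obtain ⟨δ, hδ, ht⟩ := Metric.eventually_nhds_iff.1 ht
  -- The bound `1` gives `ε² ≤ |ε|`. The second bound, with `|x| ≤ L |ε|`, gives `|x| < δ` and `|x|
  -- ≤ 1/2`. The third absorbs the terms of order `ε³` and `ε⁴`.
  refine ⟨min 1 (min (min δ 1 / (2 * L)) (η / (2 * (D + 1)))), by positivity, ?_⟩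
  intro s h ε hs hh hε
  have hε1 : |ε| ≤ 1 := hε.trans (min_le_left _ _)
  have hε2 : |ε| ≤ min δ 1 / (2 * L) := hε.trans ((min_le_right _ _).trans (min_le_left _ _))
  have hε3 : |ε| ≤ η / (2 * (D + 1)) := hε.trans ((min_le_right _ _).trans (min_le_right _ _))
  have hsS : |s| ≤ S' := hs.trans hSS
  have hm : |s ^ 2 + h| ≤ M := by
    refine (abs_add_le _ _).trans (le_trans (add_le_add ?_ hh) hHM)
    rw [abs_pow]
    gcongr
  set m := s ^ 2 + h with hmdef
  clear_value m
  set x := -2 * s * ε + m * ε ^ 2 with hx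
  have hxL : |x| ≤ L * |ε| := by
    refine (abs_add_le _ _).trans ?_
    rw [abs_mul, abs_mul, abs_mul, abs_pow, hL, add_mul]
    have : |ε| ^ 2 ≤ |ε| := by nlinarith [abs_nonneg ε]
    have e1 : |(-2 : ℝ)| = 2 := by norm_num
    rw [e1]
    gcongr
  have hx2 : |x| ≤ min δ 1 / 2 := by
    refine hxL.trans ?_
    rw [le_div_iff₀ (by positivity)] at hε2
    linarith
  have hxδ : |x| < δ := by
    have := min_le_left δ 1
    linarith
  have hx1 : |x| ≤ 1 / 2 := by
    have := min_le_right δ 1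
    linarith
  refine ⟨by linarith [(abs_le.1 hx1).1], ?_⟩
  have h1 := ht (y := x) (by simpa [Real.dist_eq] using hxδ)
  rw [Real.norm_eq_abs, Real.norm_eq_abs, abs_of_nonneg (sq_nonneg x)] at h1
  have hxx : x ^ 2 ≤ L ^ 2 * ε ^ 2 := by
    rw [← sq_abs x, ← sq_abs ε, ← mul_pow]
    gcongr
  have h2 : η / (2 * L ^ 2) * x ^ 2 ≤ η / 2 * ε ^ 2 := by
    calc η / (2 * L ^ 2) * x ^ 2 ≤ η / (2 * L ^ 2) * (L ^ 2 * ε ^ 2) := by gcongr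
      _ = η / 2 * ε ^ 2 := by field_simp
  -- These are the cubic and quartic terms of `x²`; `q (q + 2) / 8` is the second binomial
  -- coefficient of the exponent `-q/2`.
  have h3 : |q * (q + 2) / 8 * (-4 * s * m * ε + m ^ 2 * ε ^ 2) * ε ^ 2| ≤ η / 2 * ε ^ 2 := by
    rw [abs_mul, abs_of_nonneg (sq_nonneg ε)]
    refine mul_le_mul_of_nonneg_right ?_ (sq_nonneg ε)
    have e2 : |-4 * s * m * ε + m ^ 2 * ε ^ 2| ≤ (4 * S' * M + M ^ 2) * |ε| := by
      have e3 : |ε| ^ 2 ≤ |ε| := by nlinarith [abs_nonneg ε]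
      have e4 : |-4 * s * m * ε| ≤ 4 * S' * M * |ε| := by
        rw [abs_mul, abs_mul, abs_mul, show |(-4 : ℝ)| = 4 by norm_num]
        gcongr
      have e5 : |m ^ 2 * ε ^ 2| ≤ M ^ 2 * |ε| := by
        rw [abs_mul, abs_pow, abs_pow]
        gcongr
      rw [add_mul]
      exact (abs_add_le _ _).trans (add_le_add e4 e5)
    rw [abs_mul]
    rw [le_div_iff₀ (by positivity)] at hε3
    calc |q * (q + 2) / 8| * |-4 * s * m * ε + m ^ 2 * ε ^ 2|
        ≤ |q * (q + 2) / 8| * ((4 * S' * M + M ^ 2) * |ε|) := by gcongr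
      _ = D * |ε| := by rw [hD]; ring
      _ ≤ η / 2 := by nlinarith [abs_nonneg ε]
  have h4 : (1 + x) ^ (-(q / 2)) - (1 + q * s * ε + q / 2 * ((q + 1) * s ^ 2 - h) * ε ^ 2) =
      ((1 + x) ^ (-(q / 2)) - (1 + -(q / 2) * x + -(q / 2) * (-(q / 2) - 1) / 2 * x ^ 2)) +
      q * (q + 2) / 8 * (-4 * s * m * ε + m ^ 2 * ε ^ 2) * ε ^ 2 := by
    have : h = m - s ^ 2 := by rw [hmdef]; ring
    rw [this, hx]
    ring
  rw [h4]
  refine (abs_add_le _ _).trans ?_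
  linarith

/-! ### Images, and the uniform expansion of the strip kernel -/

/-- The vertical displacement of `p` from the reflection of order `j` of `p'`. -/
def imageShift {n : ℕ} (j : ℤ) (z : Space n × Space n) : ℝ :=
  height z.1 - (-1) ^ j * height z.2

theorem dist_rho_sq {n : ℕ} (t : ℝ) (j : ℤ) (z : Space n × Space n) :
    dist z.1 (rho t j z.2) ^ 2 =
      horizDistSq z.1 z.2 + (imageShift j z - 2 * t * j) ^ 2 := by
  rw [EuclideanSpace.dist_eq, Real.sq_sqrt (Finset.sum_nonneg fun i _ => sq_nonneg _),
    Fin.sum_univ_castSucc]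
  congr 1
  · refine Finset.sum_congr rfl fun i _ => ?_
    have : i.castSucc ≠ Fin.last n := (Fin.castSucc_lt_last i).ne
    simp [rho, Real.dist_eq, this]
  · simp only [rho, Real.dist_eq, Function.update_self, sq_abs, imageShift]
    rw [← height]
    ring

theorem rho_zero {n : ℕ} (t : ℝ) (p : Space n) : rho t 0 p = p := by
  ext i
  by_cases h : i = Fin.last n
  · subst h
    simp [rho, height]
  · simp [rho, h]

theorem abs_height_le {n : ℕ} (p : Space n) : |height p| ≤ ‖p‖ := by
  simpa [height] using PiLp.norm_apply_le p (Fin.last n)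

theorem horizDistSq_nonneg {n : ℕ} (p p' : Space n) : 0 ≤ horizDistSq p p' :=
  Finset.sum_nonneg fun _ _ => sq_nonneg _

theorem horizDistSq_le {n : ℕ} (p p' : Space n) : horizDistSq p p' ≤ dist p p' ^ 2 := by
  have h := dist_rho_sq 0 0 (p, p')
  rw [rho_zero] at h
  rw [h]
  simpa using sq_nonneg _

theorem continuous_height {n : ℕ} : Continuous (height (n := n)) := by
  unfold height
  fun_prop

theorem continuous_horizDistSq {n : ℕ} :
    Continuous fun z : Space n × Space n => horizDistSq z.1 z.2 := by
  unfold horizDistSq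
  fun_prop

theorem abs_imageShift_le {n : ℕ} (j : ℤ) {R : ℝ} {z : Space n × Space n}
    (h1 : ‖z.1‖ ≤ R) (h2 : ‖z.2‖ ≤ R) : |imageShift j z| ≤ 2 * R := by
  unfold imageShift
  refine (abs_sub _ _).trans ?_
  rw [abs_mul, abs_zpow, abs_neg, abs_one, one_zpow, one_mul]
  linarith [abs_height_le z.1, abs_height_le z.2]

theorem abs_horizDistSq_le {n : ℕ} {R : ℝ} {z : Space n × Space n}
    (h1 : ‖z.1‖ ≤ R) (h2 : ‖z.2‖ ≤ R) : |horizDistSq z.1 z.2| ≤ (2 * R) ^ 2 := by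
  rw [abs_of_nonneg (horizDistSq_nonneg _ _)]
  refine (horizDistSq_le _ _).trans ?_
  gcongr
  linarith [dist_le_norm_add_norm z.1 z.2]

/-- The contribution of the reflection of order `j` to the renormalized strip kernel. -/
def imageTerm {n : ℕ} (q t : ℝ) (z : Space n × Space n) (j : {j : ℤ // j ≠ 0}) : ℝ :=
  1 / dist z.1 (rho t j z.2) ^ q - 1 / |2 * t * ((j : ℤ) : ℝ)| ^ q

/-- The coefficient of `(2t)^(-q-2)` in the expansion of the strip kernel. -/
def quadKernel {n : ℕ} (q : ℝ) (z : Space n × Space n) : ℝ :=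
  -(coeffB q * (horizDistSq z.1 z.2 - (q + 1) * (height z.1 - height z.2) ^ 2)) +
    coeffC q * (height z.1 * height z.2)

theorem abs_intCast_pos (j : {j : ℤ // j ≠ 0}) : 0 < |((j : ℤ) : ℝ)| :=
  abs_pos.2 (Int.cast_ne_zero.2 j.2)

theorem one_div_abs_rpow {t : ℝ} (ht : 0 < t) (j : ℤ) (s : ℝ) :
    1 / |2 * t * (j : ℝ)| ^ s = 1 / (2 * t) ^ s * (1 / |(j : ℝ)| ^ s) := by
  rw [abs_mul, abs_of_pos (by positivity : 0 < 2 * t),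
    Real.mul_rpow (by positivity) (abs_nonneg _), one_div_mul_one_div]

theorem summable_one_div_abs_rpow {s : ℝ} (hs : 1 < s) :
    Summable fun j : {j : ℤ // j ≠ 0} => 1 / |((j : ℤ) : ℝ)| ^ s := by
  have h := (Real.summable_abs_int_rpow hs).subtype {j : ℤ | j ≠ 0}
  refine h.congr fun j => ?_
  simp [Real.rpow_neg]

theorem summable_one_div_abs_mul_rpow {t : ℝ} (ht : 0 < t) {s : ℝ} (hs : 1 < s) :
    Summable fun j : {j : ℤ // j ≠ 0} => 1 / |2 * t * ((j : ℤ) : ℝ)| ^ s := by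
  simp_rw [one_div_abs_rpow ht]
  exact (summable_one_div_abs_rpow hs).mul_left _

theorem tsum_one_div_abs_mul_rpow {t : ℝ} (ht : 0 < t) {s : ℝ} (hs : 1 < s) :
    ∑' j : {j : ℤ // j ≠ 0}, 1 / |2 * t * ((j : ℤ) : ℝ)| ^ s =
      1 / (2 * t) ^ s * (2 * (riemannZeta (s : ℂ)).re) := by
  simp_rw [one_div_abs_rpow ht]
  rw [tsum_mul_left, two_zeta_eq hs]

theorem imageShift_neg {n : ℕ} (j : ℤ) (z : Space n × Space n) :
    imageShift (-j) z = imageShift j z := by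
  unfold imageShift
  rw [zpow_neg, ← inv_zpow, inv_neg, inv_one]

-- The excess `4zw` at odd `j` is what later becomes the `C_q` term.
open Classical in
theorem imageShift_sq {n : ℕ} (j : ℤ) (z : Space n × Space n) :
    imageShift j z ^ 2 = (height z.1 - height z.2) ^ 2 +
      4 * (height z.1 * height z.2) * (if Odd j then 1 else 0) := by
  unfold imageShift
  rcases Int.even_or_odd j with h | h
  · rw [h.neg_one_zpow, if_neg (by simpa using h)]
    ring
  · rw [h.neg_one_zpow, if_pos h]
    ring

/-- The terms of first order cancel in pairs. -/
theorem tsum_linear_terms {n : ℕ} (q t : ℝ) (z : Space n × Space n) :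
    ∑' j : {j : ℤ // j ≠ 0}, 1 / |2 * t * ((j : ℤ) : ℝ)| ^ q *
      (q * imageShift j z * (1 / (2 * t * ((j : ℤ) : ℝ)))) = 0 := by
  set f : {j : ℤ // j ≠ 0} → ℝ := fun j => 1 / |2 * t * ((j : ℤ) : ℝ)| ^ q *
      (q * imageShift j z * (1 / (2 * t * ((j : ℤ) : ℝ)))) with hf
  let e : {j : ℤ // j ≠ 0} ≃ {j : ℤ // j ≠ 0} :=
    (Equiv.neg ℤ).subtypeEquiv (fun j => by simp)
  have h1 : ∑' j, f (e j) = ∑' j, f j := e.tsum_eq f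
  have h2 : ∀ j, f (e j) = -f j := by
    intro j
    have he : ((e j : {j : ℤ // j ≠ 0}) : ℤ) = -(j : ℤ) := rfl
    simp only [hf, he, imageShift_neg, Int.cast_neg, mul_neg, abs_neg, div_neg]
  simp_rw [h2] at h1
  rw [tsum_neg] at h1
  linarith

open Classical in
theorem tsum_odd {s : ℝ} (hs : 1 < s) :
    Summable (fun j : {j : ℤ // j ≠ 0} =>
      1 / |((j : ℤ) : ℝ)| ^ s * (if Odd (j : ℤ) then 1 else 0)) ∧
    ∑' j : {j : ℤ // j ≠ 0}, 1 / |((j : ℤ) : ℝ)| ^ s * (if Odd (j : ℤ) then 1 else 0) =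
      ∑' j : {j : ℤ // Odd j}, 1 / |((j : ℤ) : ℝ)| ^ s := by
  constructor
  · refine Summable.of_nonneg_of_le (fun j => by positivity) (fun j => ?_)
      (summable_one_div_abs_rpow hs)
    refine mul_le_of_le_one_right (by positivity) ?_
    split_ifs <;> norm_num
  · set g : ℤ → ℝ := fun j => 1 / |(j : ℝ)| ^ s * (if Odd j then 1 else 0) with hg
    have h1 : ∑' j : {j : ℤ // j ≠ 0}, g j = ∑' j, g j := by
      refine tsum_subtype_eq_of_support_subset (s := {j : ℤ | j ≠ 0}) fun j hj hj0 => hj ?_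
      simp [hg, hj0]
    have h2 : ∑' j : {j : ℤ // Odd j}, g j = ∑' j, g j := by
      refine tsum_subtype_eq_of_support_subset (s := {j : ℤ | Odd j}) fun j hj => ?_
      by_contra hodd
      have hodd' : ¬ Odd j := hodd
      exact hj (by simp only [hg, if_neg hodd', mul_zero])
    refine (h1.trans h2.symm).trans (tsum_congr fun j => ?_)
    simp only [hg, if_pos j.2, mul_one]

/-- The sum over all `j ≠ 0` is `2 ζ(q + 2)`, which with the factor `q/2` gives `B_q`. The excess
`4zw` is summed over odd `j` only, and `(q/2) (q + 1) · 4 = 2q(q + 1)` gives `C_q`. -/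
theorem hasSum_quadratic_terms {n : ℕ} {q t : ℝ} (hq : 1 ≤ q) (ht : 0 < t)
    (z : Space n × Space n) :
    HasSum (fun j : {j : ℤ // j ≠ 0} => 1 / |2 * t * ((j : ℤ) : ℝ)| ^ (q + 2) *
      (q / 2 * ((q + 1) * imageShift j z ^ 2 - horizDistSq z.1 z.2)))
      (1 / (2 * t) ^ (q + 2) * quadKernel q z) := by
  classical
  have hq2 : 1 < q + 2 := by linarith
  have h1 := (summable_one_div_abs_rpow hq2).hasSum
  rw [← two_zeta_eq hq2] at h1
  have h2 := (tsum_odd hq2).1.hasSum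
  rw [(tsum_odd hq2).2] at h2
  have h3 := ((h1.mul_left (q / 2 * ((q + 1) * (height z.1 - height z.2) ^ 2 -
    horizDistSq z.1 z.2))).add (h2.mul_left (q / 2 * (q + 1) * 4 *
    (height z.1 * height z.2)))).mul_left (1 / (2 * t) ^ (q + 2))
  convert! h3 using 1
  · funext j
    rw [one_div_abs_rpow ht, imageShift_sq]
    ring
  · rw [quadKernel, coeffB, coeffC]
    ring

/-- With `y = 2tj`, vertical shift `s` and squared horizontal distance `h`, the squared distance is
`h + (s - y)²`. Factoring out `y²` leaves the base of `inverse_power_expansion` at `ε = 1/y`. -/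
theorem one_div_dist_rho_rpow {n : ℕ} {q t : ℝ} (ht : 0 < t) (j : {j : ℤ // j ≠ 0})
    (z : Space n × Space n)
    (hpos : 0 < 1 + (-2 * imageShift j z * (1 / (2 * t * ((j : ℤ) : ℝ))) +
      (imageShift j z ^ 2 + horizDistSq z.1 z.2) * (1 / (2 * t * ((j : ℤ) : ℝ))) ^ 2)) :
    0 < dist z.1 (rho t j z.2) ∧ 1 / dist z.1 (rho t j z.2) ^ q =
      1 / |2 * t * ((j : ℤ) : ℝ)| ^ q *
      (1 + (-2 * imageShift j z * (1 / (2 * t * ((j : ℤ) : ℝ))) +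
      (imageShift j z ^ 2 + horizDistSq z.1 z.2) * (1 / (2 * t * ((j : ℤ) : ℝ))) ^ 2)) ^
        (-(q / 2)) := by
  set s := imageShift j z
  set h := horizDistSq z.1 z.2
  set y := 2 * t * ((j : ℤ) : ℝ) with hy
  have hj : ((j : ℤ) : ℝ) ≠ 0 := Int.cast_ne_zero.2 j.2
  have hy0 : y ≠ 0 := by positivity
  have hd : dist z.1 (rho t j z.2) ^ 2 =
      |y| ^ 2 * (1 + (-2 * s * (1 / y) + (s ^ 2 + h) * (1 / y) ^ 2)) := by
    rw [dist_rho_sq, sq_abs]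
    change h + (s - y) ^ 2 = _
    field_simp
    ring
  set x := 1 + (-2 * s * (1 / y) + (s ^ 2 + h) * (1 / y) ^ 2)
  have hya : 0 < |y| := abs_pos.2 hy0
  have hdpos : 0 < dist z.1 (rho t j z.2) := by
    have : 0 < dist z.1 (rho t j z.2) ^ 2 := by
      rw [hd]
      positivity
    exact lt_of_le_of_ne dist_nonneg fun h0 => by simp [← h0] at this
  refine ⟨hdpos, ?_⟩
  have hr : ∀ a : ℝ, 0 < a → a ^ q = (a ^ 2) ^ (q / 2) := by
    intro a ha
    rw [← Real.rpow_natCast, ← Real.rpow_mul ha.le]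
    congr 1
    push_cast
    ring
  rw [hr _ hdpos, hd, Real.mul_rpow (by positivity) hpos.le, ← hr _ hya, Real.rpow_neg hpos.le,
    ← one_div, one_div_mul_one_div]

theorem imageTerm_expansion (n : ℕ) (q R : ℝ) {η : ℝ} (hη : 0 < η) :
    ∀ᶠ t in atTop, ∀ z : Space n × Space n, ‖z.1‖ ≤ R → ‖z.2‖ ≤ R → ∀ j : {j : ℤ // j ≠ 0},
      0 < dist z.1 (rho t j z.2) ∧
      |imageTerm q t z j - (1 / |2 * t * ((j : ℤ) : ℝ)| ^ q *
        (q * imageShift j z * (1 / (2 * t * ((j : ℤ) : ℝ)))) +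
        1 / |2 * t * ((j : ℤ) : ℝ)| ^ (q + 2) *
        (q / 2 * ((q + 1) * imageShift j z ^ 2 - horizDistSq z.1 z.2)))| ≤
      η * (1 / |2 * t * ((j : ℤ) : ℝ)| ^ (q + 2)) := by
  obtain ⟨ε₀, hε₀, h⟩ := inverse_power_expansion q (2 * R) ((2 * R) ^ 2) hη
  filter_upwards [eventually_gt_atTop 0, eventually_ge_atTop (1 / ε₀)] with t ht ht2 z h1 h2 j
  have hj := abs_intCast_pos j
  have hj1 : 1 ≤ |((j : ℤ) : ℝ)| := by exact_mod_cast Int.one_le_abs j.2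
  have hy : 0 < |2 * t * ((j : ℤ) : ℝ)| := by
    rw [abs_mul]
    positivity
  -- Since `|j| ≥ 1`, a single threshold on `t` serves every image; the expansion is uniform in `j`
  -- as well as in `z`.
  have hε : |1 / (2 * t * ((j : ℤ) : ℝ))| ≤ ε₀ := by
    rw [abs_div, abs_one, div_le_iff₀ hy, abs_mul, abs_of_pos (by positivity : 0 < 2 * t)]
    rw [div_le_iff₀ hε₀] at ht2
    nlinarith [mul_pos ht hε₀]
  obtain ⟨h3, h4⟩ := h _ _ _ (abs_imageShift_le j h1 h2) (abs_horizDistSq_le h1 h2) hε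
  obtain ⟨h5, h6⟩ := one_div_dist_rho_rpow (q := q) ht j z h3
  refine ⟨h5, ?_⟩
  have h7 : 1 / |2 * t * ((j : ℤ) : ℝ)| ^ (q + 2) =
      1 / |2 * t * ((j : ℤ) : ℝ)| ^ q * (1 / (2 * t * ((j : ℤ) : ℝ))) ^ 2 := by
    rw [Real.rpow_add hy, Real.rpow_two, sq_abs, one_div_pow, one_div_mul_one_div]
  rw [imageTerm, h6, h7]
  set P := 1 / |2 * t * ((j : ℤ) : ℝ)| ^ q with hP
  have hP0 : 0 ≤ P := by positivity
  rw [mul_left_comm η, ← abs_of_nonneg hP0]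
  refine le_trans (le_of_eq ?_) (mul_le_mul_of_nonneg_left h4 (abs_nonneg P))
  rw [← abs_mul, abs_of_nonneg hP0]
  congr 1
  ring

/-- The difference between the strip kernel and the Riesz kernel. -/
def stripRemainder {n : ℕ} (q t : ℝ) (z : Space n × Space n) : ℝ :=
  coeffA q t / (2 * t) ^ q + ∑' j : {j : ℤ // j ≠ 0}, imageTerm q t z j

/-- After the constant term is subtracted, an image contributes `O(|2tj|^(-(q+1)))`. This is
summable even at `q = 1`, and it is the majorant behind both summability and continuity of the
remainder. -/
theorem abs_imageTerm_le (n : ℕ) {q : ℝ} (hq : 1 ≤ q) (R : ℝ) :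
    ∃ D, ∀ᶠ t in atTop, ∀ z : Space n × Space n, ‖z.1‖ ≤ R → ‖z.2‖ ≤ R →
      ∀ j : {j : ℤ // j ≠ 0}, 0 < dist z.1 (rho t j z.2) ∧
      |imageTerm q t z j| ≤ D * (1 / |2 * t * ((j : ℤ) : ℝ)| ^ (q + 1)) := by
  -- The summands bound the linear term, the quadratic term, and the expansion error with `η = 1`;
  -- the last two decay faster and are weakened to exponent `q + 1`.
  refine ⟨q * (2 * R) + q / 2 * ((q + 1) * (2 * R) ^ 2 + (2 * R) ^ 2) + 1, ?_⟩
  filter_upwards [imageTerm_expansion n q R one_pos, eventually_ge_atTop 1] with t h ht z h1 h2 j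
  obtain ⟨h3, h4⟩ := h z h1 h2 j
  refine ⟨h3, ?_⟩
  have hj1 : 1 ≤ |((j : ℤ) : ℝ)| := by exact_mod_cast Int.one_le_abs j.2
  have hs := abs_imageShift_le j h1 h2
  have hd := abs_horizDistSq_le h1 h2
  have hy1 : 1 ≤ |2 * t * ((j : ℤ) : ℝ)| := by
    rw [abs_mul, abs_of_pos (by positivity : 0 < 2 * t)]
    nlinarith
  have e1 : 1 / |2 * t * ((j : ℤ) : ℝ)| ^ (q + 1) =
      1 / |2 * t * ((j : ℤ) : ℝ)| ^ q * |1 / (2 * t * ((j : ℤ) : ℝ))| := by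
    rw [Real.rpow_add (by positivity), Real.rpow_one, abs_div, abs_one, one_div_mul_one_div]
  have e2 : 1 / |2 * t * ((j : ℤ) : ℝ)| ^ (q + 2) ≤ 1 / |2 * t * ((j : ℤ) : ℝ)| ^ (q + 1) :=
    one_div_le_one_div_of_le (by positivity) (Real.rpow_le_rpow_of_exponent_le hy1 (by linarith))
  set s := imageShift (j : ℤ) z
  set y := 2 * t * ((j : ℤ) : ℝ)
  set W := 1 / |y| ^ (q + 1)
  have hW : 0 ≤ W := by positivity
  clear_value W s y
  have f1 : |1 / |y| ^ q * (q * s * (1 / y))| ≤ q * (2 * R) * W := by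
    rw [abs_mul, abs_mul, abs_mul, abs_of_nonneg (by positivity : 0 ≤ 1 / |y| ^ q),
      abs_of_nonneg (by linarith : 0 ≤ q), e1]
    calc 1 / |y| ^ q * (q * |s| * |1 / y|) ≤ 1 / |y| ^ q * (q * (2 * R) * |1 / y|) := by gcongr
      _ = _ := by ring
  have f2 : |1 / |y| ^ (q + 2) * (q / 2 * ((q + 1) * s ^ 2 - horizDistSq z.1 z.2))| ≤
      q / 2 * ((q + 1) * (2 * R) ^ 2 + (2 * R) ^ 2) * W := by
    have g1 : |(q + 1) * s ^ 2 - horizDistSq z.1 z.2| ≤ (q + 1) * (2 * R) ^ 2 + (2 * R) ^ 2 := by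
      refine (abs_sub _ _).trans (add_le_add ?_ hd)
      rw [abs_mul, abs_of_nonneg (by linarith : 0 ≤ q + 1), abs_pow]
      gcongr
    rw [abs_mul, abs_mul, abs_of_nonneg (by positivity : 0 ≤ 1 / |y| ^ (q + 2)),
      abs_of_nonneg (by linarith : 0 ≤ q / 2), mul_comm]
    gcongr
  set T := imageTerm q t z j
  have f3 : |T| ≤ |T - (1 / |y| ^ q * (q * s * (1 / y)) +
      1 / |y| ^ (q + 2) * (q / 2 * ((q + 1) * s ^ 2 - horizDistSq z.1 z.2)))| +
      (|1 / |y| ^ q * (q * s * (1 / y))| +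
      |1 / |y| ^ (q + 2) * (q / 2 * ((q + 1) * s ^ 2 - horizDistSq z.1 z.2))|) := by
    refine le_trans (le_of_eq ?_) ((abs_add_le _ _).trans (add_le_add le_rfl (abs_add_le _ _)))
    congr 1
    ring
  linarith

theorem continuous_rho {n : ℕ} (t : ℝ) (j : ℤ) : Continuous (rho t j : Space n → Space n) := by
  refine (PiLp.continuous_toLp 2 _).comp (Continuous.update (by fun_prop) _ ?_)
  have := continuous_height (n := n)
  fun_prop

theorem continuousOn_stripRemainder (n : ℕ) {q : ℝ} (hq : 1 ≤ q) (R : ℝ) :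
    ∀ᶠ t in atTop, ContinuousOn (stripRemainder (n := n) q t) {z | ‖z.1‖ ≤ R ∧ ‖z.2‖ ≤ R} := by
  obtain ⟨D, hD⟩ := abs_imageTerm_le n hq R
  filter_upwards [hD, eventually_gt_atTop 0] with t h ht
  refine continuousOn_const.add (continuousOn_tsum (fun j => ?_)
    ((summable_one_div_abs_mul_rpow ht (by linarith : 1 < q + 1)).mul_left D)
    fun j z hz => (h z hz.1 hz.2 j).2)
  have hc : Continuous fun z : Space n × Space n => dist z.1 (rho t j z.2) :=
    continuous_fst.dist ((continuous_rho t j).comp continuous_snd)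
  refine ContinuousOn.sub (continuousOn_const.div (hc.continuousOn.rpow_const fun z hz =>
    Or.inr (by linarith)) fun z hz => ?_) continuousOn_const
  exact (Real.rpow_pos_of_pos (h z hz.1 hz.2 j).1 _).ne'

theorem stripRemainder_expansion (n : ℕ) {q : ℝ} (hq : 1 ≤ q) (R : ℝ) {η : ℝ}
    (hη : 0 < η) :
    ∀ᶠ t in atTop, ∀ z : Space n × Space n, ‖z.1‖ ≤ R → ‖z.2‖ ≤ R →
      |stripRemainder q t z - (coeffA q t / (2 * t) ^ q + 1 / (2 * t) ^ (q + 2) * quadKernel q z)| ≤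
        η * (1 / (2 * t) ^ (q + 2)) := by
  have hq2 : 1 < q + 2 := by linarith
  set Z := 2 * (riemannZeta ((q + 2 : ℝ) : ℂ)).re with hZ
  have hZ0 : 0 ≤ Z := by
    rw [hZ, two_zeta_eq hq2]
    exact tsum_nonneg fun j => by positivity
  obtain ⟨D, hD⟩ := abs_imageTerm_le n hq R
  -- Summing the errors over `j` multiplies them by `Z`; the `+ 1` keeps the denominator positive.
  filter_upwards [hD, imageTerm_expansion n q R (η := η / (Z + 1)) (by positivity),
    eventually_gt_atTop 0] with t h1 h2 ht z hz1 hz2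
  have sT : Summable (imageTerm q t z) :=
    Summable.of_norm_bounded ((summable_one_div_abs_mul_rpow ht (by linarith : 1 < q + 1)).mul_left D)
      fun j => (h1 z hz1 hz2 j).2
  have sL : Summable fun j : {j : ℤ // j ≠ 0} => 1 / |2 * t * ((j : ℤ) : ℝ)| ^ q *
      (q * imageShift j z * (1 / (2 * t * ((j : ℤ) : ℝ)))) := by
    refine Summable.of_norm_bounded
      ((summable_one_div_abs_mul_rpow ht (by linarith : 1 < q + 1)).mul_left (q * (2 * R)))
      fun j => ?_
    have hy : 0 < |2 * t * ((j : ℤ) : ℝ)| := by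
      rw [abs_mul]
      have := abs_intCast_pos j
      positivity
    have hs := abs_imageShift_le j hz1 hz2
    rw [Real.rpow_add hy, Real.rpow_one, Real.norm_eq_abs, abs_mul (1 / _), abs_mul (q * _),
      abs_mul q,
      abs_of_nonneg (by positivity : 0 ≤ 1 / |2 * t * ((j : ℤ) : ℝ)| ^ q),
      abs_of_nonneg (by linarith : 0 ≤ q), abs_div, abs_one, ← one_div_mul_one_div]
    calc _ ≤ 1 / |2 * t * ((j : ℤ) : ℝ)| ^ q * (q * (2 * R) * (1 / |2 * t * ((j : ℤ) : ℝ)|)) := by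
          gcongr
      _ = _ := by ring
  have hQ := hasSum_quadratic_terms hq ht z
  have hsum := sT.hasSum.sub (sL.hasSum.add hQ)
  rw [tsum_linear_terms, zero_add] at hsum
  have hw := (summable_one_div_abs_mul_rpow ht hq2).hasSum
  rw [tsum_one_div_abs_mul_rpow ht hq2, ← hZ] at hw
  have hb := tsum_of_norm_bounded (f := fun j : {j : ℤ // j ≠ 0} => imageTerm q t z j -
    (1 / |2 * t * ((j : ℤ) : ℝ)| ^ q *
      (q * imageShift j z * (1 / (2 * t * ((j : ℤ) : ℝ)))) +
      1 / |2 * t * ((j : ℤ) : ℝ)| ^ (q + 2) *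
      (q / 2 * ((q + 1) * imageShift j z ^ 2 - horizDistSq z.1 z.2))))
    (hw.mul_left (η / (Z + 1))) fun j => (h2 z hz1 hz2 j).2
  rw [hsum.tsum_eq, Real.norm_eq_abs] at hb
  rw [stripRemainder, add_sub_add_left_eq_sub]
  refine hb.trans ?_
  have ht0 : 0 ≤ 1 / (2 * t) ^ (q + 2) := by positivity
  have : η / (Z + 1) * Z ≤ η := by
    rw [div_mul_eq_mul_div, div_le_iff₀ (by positivity)]
    nlinarith
  calc _ = (η / (Z + 1) * Z) * (1 / (2 * t) ^ (q + 2)) := by ring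
    _ ≤ _ := by gcongr

/-- For large `t` no image with `j ≠ 0` meets the ball, so the kernel is infinite only on the
diagonal. For `q > 1` the subtracted constants sum to `2 ζ(q) / (2t)^q`, which `coeffA` restores.
For `q = 1` the sum is already renormalized, and `coeffA 1 t / (2t)` is the added constant `(γ - log
(4t)) / t`. -/
theorem stripKernel_eq (n : ℕ) {q : ℝ} (hq : 1 ≤ q) (R : ℝ) :
    ∀ᶠ t in atTop, ∀ z : Space n × Space n, ‖z.1‖ ≤ R → ‖z.2‖ ≤ R →
      (z.1 = z.2 → stripKernel q t z.1 z.2 = ⊤) ∧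
      (z.1 ≠ z.2 → stripKernel q t z.1 z.2 =
        ((1 / dist z.1 z.2 ^ q + stripRemainder q t z : ℝ) : EReal)) := by
  obtain ⟨D, hD⟩ := abs_imageTerm_le n hq R
  filter_upwards [hD, eventually_gt_atTop 0] with t h ht z h1 h2
  constructor
  · intro he
    rw [stripKernel, if_pos ⟨0, by rw [rho_zero, he]⟩]
  · intro hne
    have hno : ¬ ∃ j : ℤ, z.1 = rho t j z.2 := by
      rintro ⟨j, hj⟩
      by_cases hj0 : j = 0
      · subst hj0
        rw [rho_zero] at hj
        exact hne hj
      · have := (h z h1 h2 ⟨j, hj0⟩).1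
        rw [← hj, dist_self] at this
        exact lt_irrefl _ this
    rw [stripKernel, if_neg hno]
    have sT : Summable (imageTerm q t z) :=
      Summable.of_norm_bounded
        ((summable_one_div_abs_mul_rpow ht (by linarith : 1 < q + 1)).mul_left D)
        fun j => (h z h1 h2 j).2
    by_cases hq1 : q = 1
    · subst hq1
      rw [if_pos rfl, stripRemainder, coeffA, if_pos rfl]
      simp only [imageTerm, Real.rpow_one]
      congr 1
      have : t ≠ 0 := ht.ne'
      field_simp
      ring
    · have hq1' : 1 < q := lt_of_le_of_ne hq (Ne.symm hq1)
      rw [if_neg hq1, stripRemainder, coeffA, if_neg hq1]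
      congr 1
      set f : ℤ → ℝ := fun j => 1 / dist z.1 (rho t j z.2) ^ q with hf
      have hfs : HasSum (fun j : {j : ℤ // j ≠ 0} => f j)
          ((∑' j, imageTerm q t z j) + 1 / (2 * t) ^ q * (2 * (riemannZeta (q : ℂ)).re)) := by
        have hw := (summable_one_div_abs_mul_rpow ht hq1').hasSum
        rw [tsum_one_div_abs_mul_rpow ht hq1'] at hw
        refine (sT.hasSum.add hw).congr_fun ?_
        intro j
        simp [hf, imageTerm]
      have hall := (Finset.hasSum_compl_iff {0}).1
        ((Equiv.hasSum_iff (Equiv.subtypeEquivRight fun j => by simp :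
          {j : ℤ // j ∉ ({0} : Finset ℤ)} ≃ {j : ℤ // j ≠ 0})).2 hfs)
      rw [Finset.sum_singleton] at hall
      rw [hall.tsum_eq, hf]
      simp only [rho_zero]
      ring

theorem tendsto_coeffA_div {q : ℝ} (hq : 1 ≤ q) :
    Tendsto (fun t => coeffA q t / (2 * t) ^ q) atTop (𝓝 0) := by
  have h2t : Tendsto (fun t : ℝ => 2 * t) atTop atTop := tendsto_id.const_mul_atTop two_pos
  by_cases hq1 : q = 1
  · subst hq1
    simp only [coeffA, if_true, Real.rpow_one]
    have h4 : Tendsto (fun t : ℝ => 4 * t) atTop atTop := tendsto_id.const_mul_atTop four_pos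
    have h1 : Tendsto (fun t : ℝ => Real.log (4 * t) / (4 * t)) atTop (𝓝 0) :=
      Real.isLittleO_log_id_atTop.tendsto_div_nhds_zero.comp h4
    have h3 : Tendsto (fun t : ℝ => Real.eulerMascheroniConstant / t) atTop (𝓝 0) :=
      tendsto_const_nhds.div_atTop tendsto_id
    have h5 := h3.sub (h1.const_mul 4)
    rw [mul_zero, sub_zero] at h5
    refine h5.congr' ?_
    filter_upwards [eventually_gt_atTop 0] with t ht
    field_simp
  · simp only [coeffA, if_neg hq1]
    exact tendsto_const_nhds.div_atTop ((tendsto_rpow_atTop (by linarith)).comp h2t)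

theorem tendsto_one_div_two_mul_rpow {s : ℝ} (hs : 0 < s) :
    Tendsto (fun t : ℝ => 1 / (2 * t) ^ s) atTop (𝓝 0) :=
  tendsto_const_nhds.div_atTop
    ((tendsto_rpow_atTop hs).comp (tendsto_id.const_mul_atTop two_pos))

theorem continuous_quadKernel {n : ℕ} (q : ℝ) :
    Continuous (quadKernel q : Space n × Space n → ℝ) := by
  unfold quadKernel
  have h1 := continuous_height (n := n)
  have h2 := continuous_horizDistSq (n := n)
  fun_prop

/-- Uniform smallness of the remainder makes the strip kernel nonnegative on a bounded set once `t`
is large. -/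
theorem abs_stripRemainder_le (n : ℕ) {q : ℝ} (hq : 1 ≤ q) (R : ℝ) {η : ℝ}
    (hη : 0 < η) :
    ∀ᶠ t in atTop, ∀ z : Space n × Space n, ‖z.1‖ ≤ R → ‖z.2‖ ≤ R →
      |stripRemainder q t z| ≤ η := by
  obtain ⟨C, hC⟩ := ((isCompact_closedBall (0 : Space n) R).prod
    (isCompact_closedBall (0 : Space n) R)).exists_bound_of_continuousOn
    (continuous_quadKernel q).continuousOn
  have h1 := (tendsto_coeffA_div hq).abs.add
    ((tendsto_one_div_two_mul_rpow (by linarith : 0 < q + 2)).mul_const (C + 1))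
  rw [abs_zero, zero_mul, zero_add] at h1
  filter_upwards [h1.eventually_lt_const hη, stripRemainder_expansion n hq R one_pos,
    eventually_gt_atTop 0] with t h2 h3 ht z hz1 hz2
  have h4 := h3 z hz1 hz2
  have h5 : |quadKernel q z| ≤ C := hC z ⟨by simpa using hz1, by simpa using hz2⟩
  set b := 1 / (2 * t) ^ (q + 2) with hb
  have hb0 : 0 ≤ b := by positivity
  have h6 : |b * quadKernel q z| ≤ b * C := by
    rw [abs_mul, abs_of_nonneg hb0]
    gcongr
  have h7 := abs_le.1 h4
  have h8 := abs_le.1 h6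
  have h9 := abs_le.1 (le_refl |coeffA q t / (2 * t) ^ q|)
  rw [abs_le]
  constructor <;> linarith

/-! ### Measures on the compact set, and the Riesz equilibrium measure -/

/-- A probability measure on the subtype `K`, as a measure on the ambient space. -/
def ambient {n : ℕ} {K : Set (Space n)} (m : ProbabilityMeasure K) : Measure (Space n) :=
  (m : Measure K).map Subtype.val

instance {n : ℕ} {K : Set (Space n)} (m : ProbabilityMeasure K) :
    IsProbabilityMeasure (ambient m) :=
  Measure.isProbabilityMeasure_map measurable_subtype_coe.aemeasurable

theorem ambient_mem_probOn {n : ℕ} {K : Set (Space n)} (hK : MeasurableSet K)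
    (m : ProbabilityMeasure K) : ambient m ∈ probOn K := by
  refine ⟨inferInstance, ?_⟩
  rw [ambient, Measure.map_apply measurable_subtype_coe hK.compl]
  simp

theorem exists_ambient_eq {n : ℕ} {K : Set (Space n)} (hK : MeasurableSet K)
    {μ : Measure (Space n)} (hμ : μ ∈ probOn K) : ∃ m : ProbabilityMeasure K, ambient m = μ := by
  obtain ⟨hp, h0⟩ := hμ
  have h1 : (μ.comap (Subtype.val : K → Space n)).map Subtype.val = μ := by
    rw [(MeasurableEmbedding.subtype_coe hK).map_comap, Subtype.range_coe]
    exact Measure.restrict_eq_self_of_ae_mem (mem_ae_iff.2 h0)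
  have h2 : IsProbabilityMeasure (μ.comap (Subtype.val : K → Space n)) := by
    refine ⟨?_⟩
    rw [← measure_univ (μ := μ), ← h1, Measure.map_apply measurable_subtype_coe MeasurableSet.univ,
      h1, Set.preimage_univ]
  exact ⟨⟨_, h2⟩, h1⟩

theorem ambient_injective {n : ℕ} {K : Set (Space n)} (hK : MeasurableSet K) :
    Function.Injective (ambient (K := K)) := by
  intro m m' h
  refine Subtype.ext ?_
  have h1 := congrArg (Measure.comap (Subtype.val : K → Space n)) h
  simp only [ambient, (MeasurableEmbedding.subtype_coe hK).comap_map] at h1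
  exact h1

/-- Nonnegativity on `K × K` removes the negative part, and Tonelli turns the iterated integral into
one over the product measure. -/
theorem energyIntegral_ambient {n : ℕ} {K : Set (Space n)} (hK : MeasurableSet K)
    {G : Space n → Space n → EReal} {k : K × K → ℝ≥0∞} (hk : Measurable k)
    (hG : ∀ x y : K, 0 ≤ G x y) (hGk : ∀ x y : K, (G x y).toENNReal = k (x, y))
    (m : ProbabilityMeasure K) : energyIntegral G (ambient m) = (pairEnergy k m : EReal) := by
  have he := MeasurableEmbedding.subtype_coe hK
  rw [energyIntegral, ambient]
  simp only [he.lintegral_map, hGk]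
  have h0 : ∀ x y : K, (-(G x y)).toENNReal = 0 := fun x y =>
    EReal.toENNReal_of_nonpos (by simpa using hG x y)
  simp only [h0, lintegral_zero]
  rw [pairEnergy, lintegral_prod _ hk.aemeasurable]
  simp

theorem kernelEnergy_eq_of_min {n : ℕ} {K : Set (Space n)} (hK : MeasurableSet K)
    {G : Space n → Space n → EReal} {k : K × K → ℝ≥0∞} (hk : Measurable k)
    (hG : ∀ x y : K, 0 ≤ G x y) (hGk : ∀ x y : K, (G x y).toENNReal = k (x, y))
    {m : ProbabilityMeasure K} (hm : ∀ m', pairEnergy k m ≤ pairEnergy k m') :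
    kernelEnergy G K = (pairEnergy k m : EReal) := by
  refine le_antisymm ?_ ?_
  · rw [← energyIntegral_ambient hK hk hG hGk]
    exact iInf₂_le _ (ambient_mem_probOn hK m)
  · refine le_iInf₂ fun μ hμ => ?_
    obtain ⟨m', rfl⟩ := exists_ambient_eq hK hμ
    rw [energyIntegral_ambient hK hk hG hGk]
    exact_mod_cast hm m'

theorem rieszKernel_nonneg {n : ℕ} (q : ℝ) (p p' : Space n) : 0 ≤ rieszKernel q p p' := by
  rw [rieszKernel]
  split_ifs
  · exact le_top
  · exact_mod_cast (by positivity : (0 : ℝ) ≤ 1 / dist p p' ^ q)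

theorem rieszE_of_ne {n : ℕ} (q : ℝ) {p p' : Space n} (h : p ≠ p') :
    rieszE q (p, p') = ENNReal.ofReal (1 / dist p p' ^ q) := by
  rw [rieszE, edist_dist, ENNReal.ofReal_rpow_of_pos (dist_pos.2 h), Real.rpow_neg dist_nonneg,
    one_div]

theorem rieszE_self {n : ℕ} {q : ℝ} (hq : 0 < q) (p : Space n) : rieszE q (p, p) = ⊤ := by
  rw [rieszE, edist_self, ENNReal.zero_rpow_of_neg (by linarith)]

theorem toENNReal_rieszKernel {n : ℕ} {q : ℝ} (hq : 0 < q) (p p' : Space n) :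
    (rieszKernel q p p').toENNReal = rieszE q (p, p') := by
  by_cases h : p = p'
  · subst h
    rw [rieszE_self hq, rieszKernel, if_pos rfl, EReal.toENNReal_top]
  · rw [rieszE_of_ne q h, rieszKernel, if_neg h, EReal.toENNReal_of_ne_top (EReal.coe_ne_top _),
      EReal.toReal_coe]

theorem continuous_rieszE {n : ℕ} (q : ℝ) : Continuous (rieszE q : Space n × Space n → ℝ≥0∞) :=
  ENNReal.continuous_rpow_const.comp (continuous_fst.edist continuous_snd)

/-- The inclusion of `K × K` in the square of the ambient space. -/
def inclProd {n : ℕ} (K : Set (Space n)) (z : K × K) : Space n × Space n := (z.1, z.2)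

theorem continuous_inclProd {n : ℕ} (K : Set (Space n)) : Continuous (inclProd K) := by
  unfold inclProd
  fun_prop

theorem toENNReal_rieszKernel_coe {n : ℕ} {q : ℝ} (hq : 0 < q) {K : Set (Space n)} (x y : K) :
    (rieszKernel q (x : Space n) y).toENNReal = (rieszE q ∘ inclProd K) (x, y) :=
  toENNReal_rieszKernel hq (x : Space n) (y : Space n)

theorem pairEnergy_rieszE {n : ℕ} {K : Set (Space n)} (q : ℝ) (m : ProbabilityMeasure K) :
    pairEnergy (rieszE q ∘ inclProd K) m = rieszEnergyE q (ambient m) := by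
  rw [rieszEnergyE, ambient, Measure.map_prod_map _ _ measurable_subtype_coe measurable_subtype_coe,
    lintegral_map (continuous_rieszE q).measurable (by fun_prop)]
  rfl

/-- The Riesz energy of a compact set of finite energy has a unique minimizer. -/
theorem exists_unique_riesz_min {n : ℕ} {q : ℝ} (hq : 0 < q) {K : Set (Space n)}
    (hK : IsCompact K) (hfin : rieszEnergy q K < ⊤) :
    ∃ m₀ : ProbabilityMeasure K, pairEnergy (rieszE q ∘ inclProd K) m₀ ≠ ⊤ ∧
      ∀ m, m ≠ m₀ → pairEnergy (rieszE q ∘ inclProd K) m₀ < pairEnergy (rieszE q ∘ inclProd K) m := by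
  have hKm := hK.measurableSet
  have hKc : CompactSpace K := isCompact_iff_compactSpace.1 hK
  have hc : Continuous (rieszE q ∘ inclProd K) := (continuous_rieszE q).comp (continuous_inclProd K)
  rw [rieszEnergy, kernelEnergy] at hfin
  simp only [iInf_lt_iff] at hfin
  obtain ⟨μ, hμ, hμt⟩ := hfin
  obtain ⟨m₁, rfl⟩ := exists_ambient_eq hKm hμ
  rw [energyIntegral_ambient hKm hc.measurable (fun x y => rieszKernel_nonneg q (x : Space n) (y : Space n))
    (toENNReal_rieszKernel_coe hq)] at hμt
  have hm₁ : pairEnergy (rieszE q ∘ inclProd K) m₁ ≠ ⊤ := by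
    intro h
    simp [h] at hμt
  have hne : Nonempty K := by
    by_contra h
    rw [not_nonempty_iff] at h
    have := measure_univ (μ := (m₁ : Measure K))
    rw [Set.univ_eq_empty_iff.2 h] at this
    simp at this
  obtain ⟨m₀, hm₀⟩ := exists_pairEnergy_add_le hc (f := fun _ => 0) continuous_const
  simp only [add_zero] at hm₀
  have hfin₀ := ne_top_of_le_ne_top hm₁ (hm₀ m₁)
  refine ⟨m₀, hfin₀, fun m hm => lt_of_le_of_ne (hm₀ m) fun heq => ?_⟩
  rw [pairEnergy_rieszE, pairEnergy_rieszE] at heq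
  rw [pairEnergy_rieszE] at hfin₀
  -- Two distinct minimizers would have a midpoint, again a probability measure on `K`, of strictly
  -- smaller energy.
  have hlt := rieszEnergyE_midpoint_lt hq (μ := ambient m₀) (ν := ambient m)
    (fun h => hm (ambient_injective hKm h).symm) hfin₀ heq.symm
  have hmem : (2⁻¹ : ℝ≥0∞) • (ambient m₀ + ambient m) ∈ probOn K := by
    refine ⟨⟨?_⟩, ?_⟩
    · simp only [Measure.smul_apply, Measure.add_apply, measure_univ, smul_eq_mul]
      rw [one_add_one_eq_two, ENNReal.inv_mul_cancel (by simp) (by simp)]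
    · simp [(ambient_mem_probOn hKm m₀).2, (ambient_mem_probOn hKm m).2]
  obtain ⟨m', hm'⟩ := exists_ambient_eq hKm hmem
  rw [← hm', ← pairEnergy_rieszE, ← pairEnergy_rieszE] at hlt
  exact absurd (hm₀ m') (not_le.2 hlt)

theorem stripKernel_properties (n : ℕ) {q : ℝ} (hq : 1 ≤ q) (R : ℝ) :
    ∀ᶠ t in atTop, ∀ p p' : Space n, ‖p‖ ≤ R → ‖p'‖ ≤ R →
      0 ≤ stripKernel q t p p' ∧ 0 ≤ stripRemainder q t (p, p') + 1 ∧
      (stripKernel q t p p').toENNReal + ENNReal.ofReal 1 =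
        rieszE q (p, p') + ENNReal.ofReal (stripRemainder q t (p, p') + 1) := by
  have hq0 : 0 < q := by linarith
  set S := 2 * |R| + 1 with hS
  have hS0 : 0 < S := by positivity
  -- `S` bounds the distances in the ball, so the Riesz kernel is at least `1 / S^q` there and a
  -- remainder of this size cannot make the strip kernel negative. The bound `1` makes the shift `δ
  -- = 1` sufficient.
  have hη : 0 < min 1 (1 / S ^ q) := by positivity
  filter_upwards [stripKernel_eq n hq R, abs_stripRemainder_le n hq R hη] with t h1 h2 p p' hp hp'
  have h3 := abs_le.1 (h2 (p, p') hp hp')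
  have h4 := min_le_left 1 (1 / S ^ q)
  have h5 := min_le_right 1 (1 / S ^ q)
  have h6 : 0 ≤ stripRemainder q t (p, p') + 1 := by linarith
  obtain ⟨h7, h8⟩ := h1 (p, p') hp hp'
  simp only at h7 h8
  by_cases h : p = p'
  · rw [h7 h]
    refine ⟨le_top, h6, ?_⟩
    rw [← h, rieszE_self hq0]
    simp
  · have hd : dist p p' ≤ S := by
      have := le_abs_self R
      linarith [dist_le_norm_add_norm p p']
    have hd0 := dist_pos.2 h
    have h9 : 1 / S ^ q ≤ 1 / dist p p' ^ q := by gcongr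
    have h10 : 0 ≤ 1 / dist p p' ^ q + stripRemainder q t (p, p') := by linarith
    rw [h8 h]
    refine ⟨by exact_mod_cast h10, h6, ?_⟩
    rw [EReal.toENNReal_of_ne_top (EReal.coe_ne_top _), EReal.toReal_coe, rieszE_of_ne q h,
      ← ENNReal.ofReal_add h10 zero_le_one, ← ENNReal.ofReal_add (by positivity) h6, add_assoc]

/-- The product `zw` integrates to the square of the mean height by Fubini. -/
theorem integral_quadKernel {n : ℕ} (q : ℝ) {K : Set (Space n)} (hK : IsCompact K)
    (m : ProbabilityMeasure K) :
    ∫ z, (quadKernel q ∘ inclProd K) z ∂((m : Measure K).prod m) =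
      -(coeffB q * secondMoment q (ambient m) - coeffC q * (∫ p, height p ∂(ambient m)) ^ 2) := by
  have hKc : CompactSpace K := isCompact_iff_compactSpace.1 hK
  have he := MeasurableEmbedding.subtype_coe hK.measurableSet
  have hh := continuous_height (n := n)
  have hd := (continuous_horizDistSq (n := n)).comp (continuous_inclProd K)
  have hM : Continuous fun z : K × K => horizDistSq (z.1 : Space n) z.2 -
      (q + 1) * (height (z.1 : Space n) - height (z.2 : Space n)) ^ 2 := by
    refine Continuous.sub hd ?_
    fun_prop
  have hP : Continuous fun z : K × K => height (z.1 : Space n) * height (z.2 : Space n) := by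
    fun_prop
  have hMi := hM.integrable_of_hasCompactSupport (μ := (m : Measure K).prod m)
    (HasCompactSupport.of_compactSpace _)
  have hPi := hP.integrable_of_hasCompactSupport (μ := (m : Measure K).prod m)
    (HasCompactSupport.of_compactSpace _)
  have h1 : secondMoment q (ambient m) = ∫ z : K × K, (horizDistSq (z.1 : Space n) z.2 -
      (q + 1) * (height (z.1 : Space n) - height (z.2 : Space n)) ^ 2) ∂((m : Measure K).prod m) := by
    rw [integral_prod _ hMi, secondMoment, ambient]
    simp only [he.integral_map]
  have h2 : (∫ p, height p ∂(ambient m)) ^ 2 =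
      ∫ z : K × K, height (z.1 : Space n) * height (z.2 : Space n) ∂((m : Measure K).prod m) := by
    rw [integral_prod_mul (fun x : K => height (x : Space n)) (fun x : K => height (x : Space n)),
      ambient, he.integral_map, sq]
  rw [h1, h2, ← integral_const_mul, ← integral_const_mul,
    ← integral_sub (hMi.const_mul _) (hPi.const_mul _), ← integral_neg]
  refine integral_congr_ae (ae_of_all _ fun z => ?_)
  simp only [Function.comp, inclProd, quadKernel]
  ring

end StripEnergy

end

/-! ### The expansion of the strip energy -/

open StripEnergy in
theorem theorem3p1 (n : ℕ) (q : ℝ) (hq1 : 1 ≤ q) (hqn : q < (n : ℝ) + 1)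
    (K : Set (Space n)) (hK : IsCompact K) (hfin : rieszEnergy q K < ⊤) :
    ∃ μ : Measure (Space n),
      -- `μ` is the Riesz `q`-equilibrium measure of `K`
      (IsEquilibrium (rieszKernel q) K μ ∧ ∀ ν, IsEquilibrium (rieszKernel q) K ν → ν = μ) ∧
      -- for large `t`, the strip energy is defined, is a minimum, and is finite
      (∀ᶠ t in atTop, K ⊆ strip n t ∧ (∃ μt, IsEquilibrium (stripKernel q t) K μt) ∧
        stripEnergy q t K ≠ ⊤ ∧ stripEnergy q t K ≠ ⊥) ∧
      (fun t : ℝ => (stripEnergy q t K).toReal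
          - ((rieszEnergy q K).toReal + coeffA q t / (2 * t) ^ q
            - 1 / (2 * t) ^ (q + 2)
              * (coeffB q * secondMoment q μ - coeffC q * (∫ p, height p ∂μ) ^ 2)))
        =o[atTop] (fun t : ℝ => 1 / t ^ (q + 2)) := by
  have hq0 : 0 < q := by linarith
  have hKm := hK.measurableSet
  have hKc : CompactSpace K := isCompact_iff_compactSpace.1 hK
  have hc : Continuous (rieszE q ∘ inclProd K) := (continuous_rieszE q).comp (continuous_inclProd K)
  obtain ⟨R, hR⟩ := hK.isBounded.exists_norm_le
  obtain ⟨m₀, hfin₀, hmin⟩ := exists_unique_riesz_min hq0 hK hfin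
  have hmin' : ∀ m, pairEnergy (rieszE q ∘ inclProd K) m₀ ≤ pairEnergy (rieszE q ∘ inclProd K) m := by
    intro m
    by_cases h : m = m₀
    · rw [h]
    · exact (hmin m h).le
  have hV : rieszEnergy q K = (pairEnergy (rieszE q ∘ inclProd K) m₀ : EReal) :=
    kernelEnergy_eq_of_min hKm hc.measurable (fun x y => rieszKernel_nonneg q (x : Space n) (y : Space n))
      (toENNReal_rieszKernel_coe hq0) hmin'
  have hE := energyIntegral_ambient hKm hc.measurable (fun x y => rieszKernel_nonneg q (x : Space n) (y : Space n))
      (toENNReal_rieszKernel_coe hq0)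
  set k' : ℝ → K × K → ℝ≥0∞ := fun t z => (stripKernel q t (z.1 : Space n) z.2).toENNReal with hk'
  have hr : ∀ᶠ t in atTop, Continuous (stripRemainder q t ∘ inclProd K) := by
    filter_upwards [continuousOn_stripRemainder n hq1 R] with t ht
    exact ht.comp_continuous (continuous_inclProd K) fun z => ⟨hR _ z.1.2, hR _ z.2.2⟩
  have hprop : ∀ᶠ t in atTop, ∀ x y : K, 0 ≤ stripKernel q t (x : Space n) y ∧
      0 ≤ stripRemainder q t ((x : Space n), (y : Space n)) + 1 ∧
      (stripKernel q t (x : Space n) y).toENNReal + ENNReal.ofReal 1 =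
        rieszE q ((x : Space n), (y : Space n)) +
          ENNReal.ofReal (stripRemainder q t ((x : Space n), (y : Space n)) + 1) := by
    filter_upwards [stripKernel_properties n hq1 R] with t ht x y
    exact ht x y (hR _ x.2) (hR _ y.2)
  have hmeas : ∀ᶠ t in atTop, Measurable (k' t) := by
    filter_upwards [hr, hprop] with t h1 h2
    -- Measurability of the strip kernel is read off from its decomposition into the Riesz kernel
    -- and the continuous remainder, rather than from the series.
    have h3 : k' t = fun z => (rieszE q ∘ inclProd K) z +
        ENNReal.ofReal ((stripRemainder q t ∘ inclProd K) z + 1) - ENNReal.ofReal 1 := by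
      funext z
      exact ENNReal.eq_sub_of_add_eq ENNReal.ofReal_ne_top (h2 z.1 z.2).2.2
    rw [h3]
    have h4 := hc.measurable
    have h5 := h1.measurable
    fun_prop
  obtain ⟨hex, hlo⟩ := min_pairEnergy_expansion hc hmin hfin₀
    (F := quadKernel q ∘ inclProd K) ((continuous_quadKernel q).comp (continuous_inclProd K))
    (a := fun t => coeffA q t / (2 * t) ^ q) (b := fun t => 1 / (2 * t) ^ (q + 2))
    (by filter_upwards [eventually_gt_atTop 0] with t ht; positivity)
    (tendsto_one_div_two_mul_rpow (by linarith))
    (r := fun t => stripRemainder q t ∘ inclProd K) hr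
    (fun η hη => by
      filter_upwards [stripRemainder_expansion n hq1 R hη] with t ht z
      exact ht (inclProd K z) (hR _ z.1.2) (hR _ z.2.2))
    (k' := k')
    (by
      filter_upwards [hprop] with t ht
      exact ⟨1, zero_le_one, fun z => (ht z.1 z.2).2⟩)
  have hstrip : ∀ᶠ t in atTop, ∃ m, (∀ m', pairEnergy (k' t) m ≤ pairEnergy (k' t) m') ∧
      pairEnergy (k' t) m ≠ ⊤ ∧ stripEnergy q t K = (pairEnergy (k' t) m : EReal) ∧
      IsEquilibrium (stripKernel q t) K (ambient m) := by
    filter_upwards [hex, hmeas, hprop] with t ⟨m, h1, h2⟩ h3 h4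
    have h5 := kernelEnergy_eq_of_min hKm h3 (fun x y => (h4 x y).1) (fun x y => rfl) h1
    exact ⟨m, h1, h2, h5, ambient_mem_probOn hKm m,
      (energyIntegral_ambient hKm h3 (fun x y => (h4 x y).1) (fun x y => rfl) m).trans h5.symm⟩
  refine ⟨ambient m₀, ⟨⟨ambient_mem_probOn hKm m₀, (hE m₀).trans hV.symm⟩, ?_⟩, ?_, ?_⟩
  · rintro ν ⟨hν, hνE⟩
    obtain ⟨m, rfl⟩ := exists_ambient_eq hKm hν
    by_contra hne
    have h1 := hmin m (fun h => hne (by rw [h]))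
    have h2 := (hE m).symm.trans (hνE.trans hV)
    exact h1.ne' (by exact_mod_cast h2)
  · filter_upwards [hstrip, eventually_gt_atTop R] with t ⟨m, h1, h2, h3, h4⟩ ht
    refine ⟨fun p hp => ?_, ⟨_, h4⟩, ?_, ?_⟩
    · have := (abs_height_le p).trans (hR p hp)
      exact abs_lt.1 (this.trans_lt ht)
    · rw [h3]
      simpa using h2
    · rw [h3]
      exact EReal.coe_ennreal_ne_bot _
  · have hb : (fun t : ℝ => 1 / (2 * t) ^ (q + 2)) =O[atTop] fun t : ℝ => 1 / t ^ (q + 2) := by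
      refine IsBigO.of_bound 1 ?_
      filter_upwards [eventually_gt_atTop 0] with t ht
      rw [one_mul, Real.norm_of_nonneg (by positivity), Real.norm_of_nonneg (by positivity)]
      gcongr
      linarith
    refine (hlo.trans_isBigO hb).congr' ?_ EventuallyEq.rfl
    filter_upwards [hstrip] with t ⟨m, h1, h2, h3, h4⟩
    have hinf : ⨅ m', pairEnergy (k' t) m' = pairEnergy (k' t) m :=
      le_antisymm (iInf_le _ _) (le_iInf h1)
    rw [hinf, h3, hV, integral_quadKernel q hK, EReal.toReal_coe_ennreal, EReal.toReal_coe_ennreal]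
    ring
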